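/- Let $G$ be a locally compact group with a left Haar measure $\mu$ and modular function $\Delta$, normalised by $\mu(Ex)=\Delta(x)\mu(E)$. Let $L^1(G)$ be the Banach $^*$-algebra of $\mu$-integrable functions with product $(f*g)(x)=\int_G f(h)g(h^{-1}x)\,d\mu(h)$ and involution $f^*(x)=\Delta(x^{-1})\overline{f(x^{-1})}$; $G$ is called Hermitian if every selfadjoint element of $L^1(G)$ has real spectrum. For $S\subseteq G$ put $\omega_G(S):=\limsup_{n\to\infty}\mu(S^n)^{1/n}$. Let $S\subseteq G$ be a measurable, relatively compact, symmetric ($S=S^{-1}$) set such that the subgroup generated by $S$ is not compact, and let $K\subseteq G$ be a measurable, relatively compact set with $\mu(K)>0$ and $SK\subseteq S$. If $$\omega_G(S) > \frac{\int_S \Delta^{-1/2}(h)\,d\mu(h)}{2\,\mu(K)\,\inf_{h\in S}\Delta^{-1/2}(h)},$$ then $G$ is not Hermitian. More precisely, the function $$f(g):=\frac{1}{\int_S \Delta^{-1/2}(h)\,d\mu(h)}\;\Delta^{-1/2}(g)\,\chi_S(g)$$ is a selfadjoint element of $L^1(G)$ whose spectrum is not contained in $\mathbb{R}$. -/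

import Mathlib

open MeasureTheory MeasureTheory.Measure Filter Topology
open scoped ENNReal NNReal Pointwise

set_option linter.unusedSectionVars false

namespace GroupL1

section functions

variable {G : Type*} [Group G] [TopologicalSpace G] [IsTopologicalGroup G]
  [LocallyCompactSpace G]

/-- The modular function `Δ` of `G`, normalised by `μ (E * x) = Δ x * μ E` for left Haar
measures `μ`.  Mathlib's `modularCharacter` is the reciprocal. -/
noncomputable def modularFunction (x : G) : ℝ≥0 := modularCharacter x⁻¹

lemma modularFunction_mul (x y : G) :
    modularFunction (x * y) = modularFunction x * modularFunction y := by
  simp [modularFunction, mul_comm]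

lemma modularFunction_one : modularFunction (1 : G) = 1 := by
  simp [modularFunction]

lemma modularFunction_pos (x : G) : 0 < modularFunction x :=
  modularCharacterFun_pos _

lemma modularFunction_mul_inv (x : G) : modularFunction x * modularFunction x⁻¹ = 1 := by
  rw [← modularFunction_mul, mul_inv_cancel, modularFunction_one]

variable [MeasurableSpace G] [BorelSpace G] (μ : Measure G) [μ.IsHaarMeasure]

lemma continuous_modularFunction : Continuous (modularFunction : G → ℝ≥0) := by
  have key : Continuous (fun g : G => modularCharacterFun g) := by
    borelize G
    let ν := haar (G := G)
    obtain ⟨⟨f, f_cont⟩, f_comp, f_nonneg, f_one⟩ :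
      ∃ f : C(G, ℝ), HasCompactSupport f ∧ 0 ≤ f ∧ f 1 ≠ 0 := exists_continuous_nonneg_pos 1
    have hf0 : ∫ x, f x ∂ν ≠ 0 :=
      ne_of_gt (f_cont.integral_pos_of_hasCompactSupport_nonneg_nonzero f_comp f_nonneg f_one)
    have h1 : ∀ g : G, (modularCharacterFun g : ℝ) = (∫ x, f (x * g) ∂ν) / ∫ x, f x ∂ν := by
      intro g
      rw [modularCharacterFun_eq_haarScalarFactor ν g,
        haarScalarFactor_eq_integral_div _ ν f_cont f_comp hf0,
        integral_map (AEMeasurable.mul_const aemeasurable_id' _) f_cont.aestronglyMeasurable]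
    rw [NNReal.isEmbedding_coe.continuous_iff]
    have h2 : Continuous (fun g : G => ∫ x, f (x * g) ∂ν) := by
      apply continuous_iff_continuousAt.2 (fun x₀ ↦ ?_)
      obtain ⟨t, t_comp, ht⟩ : ∃ t, IsCompact t ∧ t ∈ 𝓝 x₀ := exists_compact_mem_nhds x₀
      have hk : IsCompact (tsupport f * t⁻¹) := IsCompact.mul f_comp t_comp.inv
      have A : ContinuousOn (fun (g : G) ↦ ∫ x, f (x * g) ∂ν) t := by
        apply continuousOn_integral_of_compact_support hk
        · exact (f_cont.comp (continuous_snd.mul continuous_fst)).continuousOn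
        · intro p x hp hx
          contrapose! hx
          exact ⟨x * p, subset_tsupport _ hx, p⁻¹, by simpa using hp, by simp⟩
      exact A.continuousAt ht
    have : (NNReal.toReal ∘ fun g : G => modularCharacterFun g)
        = fun g => (∫ x, f (x * g) ∂ν) / ∫ x, f x ∂ν := by
      ext g; exact h1 g
    rw [this]
    exact h2.div_const _
  exact key.comp continuous_inv

variable [μ.Regular]

lemma map_mul_right (g : G) : map (· * g) μ = modularFunction g⁻¹ • μ := by
  have hr : (map (· * g) μ).Regular := by
    have := Regular.map (μ := μ) (Homeomorph.mulRight g)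
    simpa using this
  have := isMulLeftInvariant_eq_smul_of_regular (map (· * g) μ) μ
  rw [← modularCharacterFun_eq_haarScalarFactor] at this
  rw [this, modularFunction, inv_inv]; rfl

/-- The normalisation of the modular function. -/
lemma measure_mul_right (E : Set G) (x : G) :
    μ (E * {x}) = modularFunction x * μ E := by
  have h : E * {x} = (Homeomorph.mulRight x⁻¹) ⁻¹' E := by
    ext y; simp
  have h' : (Homeomorph.mulRight x⁻¹) ⁻¹' E
      = (Homeomorph.mulRight x⁻¹).toMeasurableEquiv ⁻¹' E := rfl
  rw [h, h', ← (Homeomorph.mulRight x⁻¹).toMeasurableEquiv.map_apply]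
  have := congrArg (fun m => m E) (map_mul_right μ x⁻¹)
  simp only [inv_inv] at this
  exact this

lemma lintegral_mul_right (φ : G → ℝ≥0∞) (g : G) :
    ∫⁻ x, φ (x * g) ∂μ = modularFunction g⁻¹ * ∫⁻ x, φ x ∂μ := by
  have := lintegral_map_equiv (μ := μ) φ (Homeomorph.mulRight g).toMeasurableEquiv
  have h2 := map_mul_right μ g
  simp only [Homeomorph.toMeasurableEquiv_coe, Homeomorph.coe_mulRight] at this
  rw [← this, h2, lintegral_smul_measure]
  rfl

/-- Sets of finite Haar measure lie in countably many compact sets. -/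
lemma exists_compact_cover {s : Set G} (hs : μ s ≠ ∞) :
    ∃ E : ℕ → Set G, (∀ n, IsCompact (E n)) ∧ (∀ n, IsClosed (E n)) ∧ s ⊆ ⋃ n, E n := by
  obtain ⟨U, hsU, hUo, hU⟩ := s.exists_isOpen_lt_of_lt ∞ hs.lt_top
  obtain ⟨V, hVc, hV⟩ := exists_compact_mem_nhds (1 : G)
  let H : Subgroup G := Subgroup.closure V
  have hHo : IsOpen (H : Set G) :=
    Subgroup.isOpen_of_mem_nhds H (g := 1) (mem_of_superset hV Subgroup.subset_closure)
  -- the subgroup is covered by countably many compact sets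
  have hH : ∃ F : ℕ → Set G, (∀ n, IsCompact (F n)) ∧ (H : Set G) ⊆ ⋃ n, F n := by
    refine ⟨fun n => (V ∪ V⁻¹) ^ n, fun n => ?_, ?_⟩
    · induction n with
      | zero => simp
      | succ n ih => simp only [pow_succ]; exact ih.mul (hVc.union hVc.inv)
    · intro x hx
      rw [Set.mem_iUnion]
      have : x ∈ Submonoid.closure (V ∪ V⁻¹) := by
        rwa [← Subgroup.closure_toSubmonoid]
      induction this using Submonoid.closure_induction with
      | mem y hy => exact ⟨1, by simpa using hy⟩
      | one => exact ⟨0, by simp⟩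
      | mul a b ha hb iha ihb =>
        have h' : ∀ z, z ∈ Submonoid.closure (V ∪ V⁻¹) → z ∈ (H : Set G) := by
          intro z hz; rwa [← Subgroup.closure_toSubmonoid] at hz
        obtain ⟨m, hm⟩ := iha (h' _ ha)
        obtain ⟨n, hn⟩ := ihb (h' _ hb)
        exact ⟨m + n, by rw [pow_add]; exact Set.mul_mem_mul hm hn⟩
  obtain ⟨F, hFc, hF⟩ := hH
  let A : G ⧸ H → Set G := fun q => U ∩ ((↑) : G → G ⧸ H) ⁻¹' {q}
  have hAo : ∀ q, IsOpen (A q) := by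
    intro q
    obtain ⟨g, rfl⟩ := QuotientGroup.mk_surjective q
    have : ((↑) : G → G ⧸ H) ⁻¹' {(g : G ⧸ H)} = g • (H : Set G) := by
      ext x
      simp [Set.mem_smul_set_iff_inv_smul_mem, eq_comm (a := (x : G ⧸ H)), QuotientGroup.eq]
    exact hUo.inter (this ▸ hHo.smul g)
  have hc : Set.Countable {q | 0 < μ (A q)} := by
    apply countable_meas_pos_of_disjoint_of_meas_iUnion_ne_top μ
      (fun q => (hAo q).measurableSet)
    · intro q r hqr
      rw [Function.onFun, Set.disjoint_left]
      rintro x ⟨-, hx⟩ ⟨-, hx'⟩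
      exact hqr (hx.symm.trans hx')
    · exact ne_top_of_le_ne_top hU.ne (measure_mono (Set.iUnion_subset fun q => Set.inter_subset_left))
  have : Countable {q | 0 < μ (A q)} := hc
  let J := {q : G ⧸ H | 0 < μ (A q)} × ℕ
  let D : Option J → Set G := fun o => o.elim ∅ fun j => closure ((j.1.1.out : G) • F j.2)
  obtain ⟨e, he⟩ := exists_surjective_nat (Option J)
  refine ⟨fun n => D (e n), fun n => ?_, fun n => ?_, fun x hx => ?_⟩
  · show IsCompact (D (e n))
    rcases e n with _ | j
    · exact isCompact_empty
    · exact ((hFc _).smul _).closure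
  · show IsClosed (D (e n))
    rcases e n with _ | j
    · exact isClosed_empty
    · exact isClosed_closure
  · have hxA : x ∈ A (x : G ⧸ H) := ⟨hsU hx, rfl⟩
    have hpos : 0 < μ (A (x : G ⧸ H)) := (hAo _).measure_pos μ ⟨x, hxA⟩
    have hxH : ((x : G ⧸ H).out)⁻¹ * x ∈ (H : Set G) := by
      rw [SetLike.mem_coe, ← QuotientGroup.eq, QuotientGroup.out_eq']
    obtain ⟨n, hn⟩ := Set.mem_iUnion.1 (hF hxH)
    obtain ⟨k, hk⟩ := he (some (⟨_, hpos⟩, n))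
    refine Set.mem_iUnion.2 ⟨k, ?_⟩
    rw [hk]
    refine subset_closure ?_
    rw [Set.mem_smul_set_iff_inv_smul_mem]
    exact hn

/-- The image of `μ` under inversion, weighted by `Δ`. -/
lemma lintegral_inv_of_isCompact {C : Set G} (hC : IsCompact C) (hC' : IsClosed C)
    {φ : G → ℝ≥0∞} (hφ : Measurable φ) :
    ∫⁻ x, C.indicator φ x⁻¹ * modularFunction x⁻¹ ∂μ = ∫⁻ x, C.indicator φ x ∂μ := by
  have hΔ : Measurable (fun x : G => (modularFunction x : ℝ≥0∞)) :=
    continuous_modularFunction.measurable.coe_nnreal_ennreal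
  let ν : Measure G := (map Inv.inv μ).withDensity (fun x => (modularFunction x : ℝ≥0∞))
  have hν : ∀ ψ : G → ℝ≥0∞, Measurable ψ →
      ∫⁻ x, ψ x ∂ν = ∫⁻ x, ψ x⁻¹ * modularFunction x⁻¹ ∂μ := by
    intro ψ hψ
    rw [lintegral_withDensity_eq_lintegral_mul _ hΔ hψ,
      lintegral_map (hΔ.mul hψ) measurable_inv]
    simp [mul_comm]
  have hνs : ∀ s, MeasurableSet s →
      ν s = ∫⁻ x, s.indicator 1 x⁻¹ * modularFunction x⁻¹ ∂μ := by
    intro s hs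
    rw [← hν _ (measurable_one.indicator hs), lintegral_indicator_one hs]
  have hinv : ν.IsMulLeftInvariant := by
    refine ⟨fun g => Measure.ext fun s hs => ?_⟩
    rw [map_apply (measurable_const_mul g) hs, hνs _ (measurable_const_mul g hs), hνs s hs]
    have h1 : ∀ x : G, ((g * ·) ⁻¹' s).indicator (1 : G → ℝ≥0∞) x⁻¹ * modularFunction x⁻¹
        = (fun y => modularFunction g⁻¹ * (s.indicator (1 : G → ℝ≥0∞) y⁻¹
            * modularFunction y⁻¹)) (x * g⁻¹) := by
      intro x
      simp only [mul_inv_rev, inv_inv, modularFunction_mul, ENNReal.coe_mul]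
      have h2 : (modularFunction g⁻¹ : ℝ≥0∞) * modularFunction g = 1 := by
        rw [← ENNReal.coe_mul, mul_comm, modularFunction_mul_inv, ENNReal.coe_one]
      have h3 : ((g * ·) ⁻¹' s).indicator (1 : G → ℝ≥0∞) x⁻¹
        = s.indicator (1 : G → ℝ≥0∞) (g * x⁻¹) := rfl
      rw [h3]
      calc _ = ((modularFunction g⁻¹ : ℝ≥0∞) * modularFunction g) *
            (s.indicator (1 : G → ℝ≥0∞) (g * x⁻¹) * modularFunction x⁻¹) := by rw [h2, one_mul]
        _ = _ := by ring
    rw [lintegral_congr h1, lintegral_mul_right μ (fun y => modularFunction g⁻¹ *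
        (s.indicator (1 : G → ℝ≥0∞) y⁻¹ * modularFunction y⁻¹)) g⁻¹, inv_inv,
      lintegral_const_mul' _ _ ENNReal.coe_ne_top, ← mul_assoc, ← ENNReal.coe_mul,
      modularFunction_mul_inv, ENNReal.coe_one, one_mul]
  have hfin : IsFiniteMeasureOnCompacts ν := by
    refine ⟨fun K hK => ?_⟩
    refine lt_of_le_of_lt (measure_mono subset_closure) ?_
    have hK' := hK.closure
    obtain ⟨B, hB⟩ := hK'.bddAbove_image
      (f := fun x : G => modularFunction x) continuous_modularFunction.continuousOn
    rw [hνs _ isClosed_closure.measurableSet]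
    calc _ ≤ ∫⁻ x, (B : ℝ≥0∞) * ((closure K)⁻¹).indicator 1 x ∂μ := by
          refine lintegral_mono fun x => ?_
          by_cases hx : x⁻¹ ∈ closure K
          · have : modularFunction x⁻¹ ≤ B := hB ⟨_, hx, rfl⟩
            simpa [hx, Set.indicator] using this
          · simp [hx, Set.indicator]
      _ < ∞ := by
          rw [lintegral_const_mul' _ _ ENNReal.coe_ne_top,
            lintegral_indicator_one (isClosed_closure.inv).measurableSet]
          exact ENNReal.mul_lt_top ENNReal.coe_lt_top hK'.inv.measure_lt_top
  set c : ℝ≥0 := haarScalarFactor ν μ with hc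
  have hr : ∀ D : Set G, IsCompact D → IsClosed D → ν.restrict D = c • μ.restrict D := by
    intro D hD hD'
    ext s hs
    rw [restrict_apply hs, Measure.smul_apply, restrict_apply hs]
    exact measure_isMulInvariant_eq_smul_of_isCompact_closure ν μ
      (hD.closure_of_subset Set.inter_subset_right)
  have hl : ∀ D : Set G, IsCompact D → IsClosed D → ∀ ψ : G → ℝ≥0∞, Measurable ψ →
      ∫⁻ x, D.indicator ψ x⁻¹ * modularFunction x⁻¹ ∂μ = c * ∫⁻ x, D.indicator ψ x ∂μ := by
    intro D hD hD' ψ hψ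
    rw [← hν _ (hψ.indicator hD'.measurableSet), lintegral_indicator hD'.measurableSet, hr D hD hD',
      lintegral_indicator hD'.measurableSet, lintegral_smul_measure]
    rfl
  have hc1 : c = 1 := by
    obtain ⟨V, hVc, hV⟩ := exists_compact_mem_nhds (1 : G)
    set D := closure V
    have hD : IsCompact D := hVc.closure
    have hDm : MeasurableSet D := isClosed_closure.measurableSet
    have e1 := hl D hD isClosed_closure 1 measurable_one
    have e2 := hl D⁻¹ hD.inv isClosed_closure.inv
      (fun x => modularFunction x⁻¹) (hΔ.comp measurable_inv)
    have e3 : ∀ x : G, (D⁻¹).indicator (fun x => (modularFunction x⁻¹ : ℝ≥0∞)) x⁻¹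
        * modularFunction x⁻¹ = D.indicator 1 x := by
      intro x
      by_cases hx : x ∈ D
      · simp [Set.indicator, hx, ← ENNReal.coe_mul, modularFunction_mul_inv]
      · simp [Set.indicator, hx]
    have e4 : ∀ x : G, D.indicator (1 : G → ℝ≥0∞) x⁻¹ * modularFunction x⁻¹
        = (D⁻¹).indicator (fun x => (modularFunction x⁻¹ : ℝ≥0∞)) x := by
      intro x
      by_cases hx : x⁻¹ ∈ D <;> simp [Set.indicator, hx]
    rw [lintegral_congr e3, ← lintegral_congr e4, e1, lintegral_indicator_one hDm,
      ← mul_assoc] at e2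
    have hpos : μ D ≠ 0 :=
      (measure_pos_of_mem_nhds μ (mem_of_superset hV subset_closure)).ne'
    have hfin' : μ D ≠ ∞ := hD.measure_lt_top.ne
    have e5 : (c : ℝ≥0∞) * c = 1 := by
      have : 1 * μ D = (c * c : ℝ≥0∞) * μ D := by rw [one_mul]; exact e2
      exact ((ENNReal.mul_left_inj hpos hfin').1 this).symm
    have e6 : c * c = 1 := by exact_mod_cast e5
    exact (pow_eq_one_iff_of_nonneg zero_le two_ne_zero).1 (by rw [sq, e6])
  rw [hl C hC hC' φ hφ, hc1, ENNReal.coe_one, one_mul]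

lemma exists_compact_exhaustion {φ : G → ℝ≥0∞} (hφ : Measurable φ) (h : ∫⁻ x, φ x ∂μ ≠ ∞) :
    ∃ C : ℕ → Set G, Monotone C ∧ (∀ n, IsCompact (C n)) ∧ (∀ n, IsClosed (C n)) ∧
      ∀ x, φ x ≠ 0 → ∃ n, x ∈ C n := by
  have h1 : ∀ k : ℕ, μ {x | ((k : ℝ≥0∞) + 1)⁻¹ ≤ φ x} ≠ ∞ := by
    intro k
    refine ((meas_ge_le_lintegral_div hφ.aemeasurable (by simp)
      (by simp)).trans_lt (ENNReal.div_lt_top h (by simp))).ne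
  choose E hEc hEcl hE using fun k => exists_compact_cover μ (h1 k)
  refine ⟨fun n => ⋃ i ∈ Set.Iic n, ⋃ j ∈ Set.Iic n, E i j, fun m n hmn => ?_, fun n => ?_,
    fun n => ?_, fun x hx => ?_⟩
  · exact Set.biUnion_mono (Set.Iic_subset_Iic.2 hmn) fun i _ =>
      Set.biUnion_subset_biUnion_left (Set.Iic_subset_Iic.2 hmn)
  · exact (Set.finite_Iic n).isCompact_biUnion fun i _ =>
      (Set.finite_Iic n).isCompact_biUnion fun j _ => hEc i j
  · exact (Set.finite_Iic n).isClosed_biUnion fun i _ =>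
      (Set.finite_Iic n).isClosed_biUnion fun j _ => hEcl i j
  · obtain ⟨k, hk⟩ := ENNReal.exists_inv_nat_lt hx
    have hk' : ((k : ℝ≥0∞) + 1)⁻¹ ≤ φ x :=
      (ENNReal.inv_le_inv.2 le_self_add).trans hk.le
    obtain ⟨j, hj⟩ := Set.mem_iUnion.1 (hE k hk')
    refine ⟨max k j, ?_⟩
    exact Set.mem_biUnion (Set.mem_Iic.2 (le_max_left k j))
      (Set.mem_biUnion (Set.mem_Iic.2 (le_max_right k j)) hj)

/-- `∫ φ(x⁻¹) Δ(x⁻¹) dμ(x) = ∫ φ dμ`. -/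
lemma lintegral_inv_mul_modularFunction {φ : G → ℝ≥0∞} (hφ : Measurable φ)
    (h : ∫⁻ x, φ x ∂μ ≠ ∞) :
    ∫⁻ x, φ x⁻¹ * modularFunction x⁻¹ ∂μ = ∫⁻ x, φ x ∂μ := by
  obtain ⟨C, hCm, hCc, hCcl, hC⟩ := exists_compact_exhaustion μ hφ h
  have hΔ : Measurable (fun x : G => (modularFunction x : ℝ≥0∞)) :=
    continuous_modularFunction.measurable.coe_nnreal_ennreal
  have h1 : ∀ x, ⨆ n, (C n).indicator φ x = φ x := by
    intro x
    refine le_antisymm (iSup_le fun n => Set.indicator_le_self _ _ _) ?_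
    by_cases hx : φ x = 0
    · simp [hx]
    · obtain ⟨n, hn⟩ := hC x hx
      exact le_iSup_of_le n (by simp [hn])
  have hmono : ∀ x, Monotone fun n => (C n).indicator φ x := fun x m n hmn =>
    Set.indicator_le_indicator_of_subset (hCm hmn) (fun _ => zero_le) x
  have hmeas : ∀ n, Measurable ((C n).indicator φ) := fun n =>
    hφ.indicator (hCcl n).measurableSet
  calc ∫⁻ x, φ x⁻¹ * modularFunction x⁻¹ ∂μ
      = ∫⁻ x, ⨆ n, (C n).indicator φ x⁻¹ * modularFunction x⁻¹ ∂μ := by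
        simp_rw [← ENNReal.iSup_mul, h1]
    _ = ⨆ n, ∫⁻ x, (C n).indicator φ x⁻¹ * modularFunction x⁻¹ ∂μ :=
        lintegral_iSup (fun n => ((hmeas n).mul hΔ).comp measurable_inv)
          (fun m n hmn x => mul_le_mul_left (hmono _ hmn) _)
    _ = ⨆ n, ∫⁻ x, (C n).indicator φ x ∂μ := by
        simp_rw [lintegral_inv_of_isCompact μ (hCc _) (hCcl _) hφ]
    _ = ∫⁻ x, φ x ∂μ := by
        rw [← lintegral_iSup hmeas (fun m n hmn x => hmono x hmn)]
        simp_rw [h1]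

lemma quasiMeasurePreserving_inv : QuasiMeasurePreserving (Inv.inv : G → G) μ μ := by
  refine ⟨measurable_inv, AbsolutelyContinuous.mk fun s hs h0 => ?_⟩
  rw [map_apply measurable_inv hs]
  have hΔ : Measurable (fun x : G => (modularFunction x : ℝ≥0∞)) :=
    continuous_modularFunction.measurable.coe_nnreal_ennreal
  have hm : Measurable (s.indicator (1 : G → ℝ≥0∞)) := measurable_one.indicator hs
  have h1 : ∫⁻ x, s.indicator (1 : G → ℝ≥0∞) x ∂μ = 0 := by
    rw [lintegral_indicator_one hs, h0]
  have h2 := lintegral_inv_mul_modularFunction μ hm (by simp [h1])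
  rw [h1] at h2
  replace h2 := (lintegral_eq_zero_iff (((hm.mul hΔ).comp measurable_inv :) : Measurable
    fun x : G => s.indicator (1 : G → ℝ≥0∞) x⁻¹ * modularFunction x⁻¹)).1 h2
  refine measure_mono_null (fun x hx => ?_) h2
  have hx' : x⁻¹ ∈ s := hx
  simp [hx', (modularFunction_pos _).ne']

lemma quasiMeasurePreserving_inv_mul (x : G) :
    QuasiMeasurePreserving (fun h : G => h⁻¹ * x) μ μ := by
  have h1 := (quasiMeasurePreserving_inv μ).comp
    (measurePreserving_mul_left μ x⁻¹).quasiMeasurePreserving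
  have h2 : (fun h : G => h⁻¹ * x) = Inv.inv ∘ fun h => x⁻¹ * h := by
    ext h; simp
  rw [h2]; exact h1


/-! ### Convolution -/

/-- `(f * g)(x) = ∫ f(h) g(h⁻¹ x) dμ(h)`. -/
noncomputable def conv (f g : G → ℂ) (x : G) : ℂ := ∫ h, f h * g (h⁻¹ * x) ∂μ

lemma integrable_of_hasSum {ι : Type*} [Countable ι] {φ : ι → G → ℂ} {Φ : G → ℂ}
    (hφ : ∀ p, Integrable (φ p) μ) (hs : Summable fun p => ∫ x, ‖φ p x‖ ∂μ)
    (h : ∀ᵐ x ∂μ, HasSum (fun p => φ p x) (Φ x)) :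
    Integrable Φ μ ∧ HasSum (fun p => ∫ x, φ p x ∂μ) (∫ x, Φ x ∂μ) := by
  constructor
  · let T : ι → Lp ℂ 1 μ := fun p => (hφ p).toL1 (φ p)
    have hT : ∑' p, ‖T p‖ₑ ≠ ∞ := by
      rw [tsum_enorm_ne_top_iff_summable_norm]
      refine hs.congr fun p => ?_
      rw [L1.norm_of_fun_eq_integral_norm]
    have h1 := Lp.hasSum_coeFn_tsum hT
    have h2 : ∀ᵐ x ∂μ, ∀ p, T p x = φ p x :=
      ae_all_iff.2 fun p => (hφ p).coeFn_toL1
    refine (L1.integrable_coeFn (∑' p, T p)).congr ?_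
    filter_upwards [h, h1, h2] with x a b c
    simp only [c] at b
    exact b.unique a
  · have := hasSum_integral_of_summable_integral_norm hφ hs
    rwa [integral_congr_ae (g := Φ)] at this
    filter_upwards [h] with x hx using hx.tsum_eq

lemma exists_compactSupport_approx {f : G → ℂ} (hf : Integrable f μ) {ε : ℝ} (hε : 0 < ε) :
    ∃ g : G → ℂ, HasCompactSupport g ∧ (∫ x, ‖f x - g x‖ ∂μ) ≤ ε ∧ Continuous g ∧
      Integrable g μ := by
  obtain ⟨g, hg, hgc, hgs⟩ : ∃ g : G → ℂ, eLpNorm (f - g) 1 μ ≤ ENNReal.ofReal ε ∧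
      (Continuous g ∧ HasCompactSupport g) := by
    refine MemLp.induction_dense ENNReal.one_ne_top
      (fun g : G → ℂ => Continuous g ∧ HasCompactSupport g) ?_ ?_ ?_
      (memLp_one_iff_integrable.2 hf) (ENNReal.ofReal_pos.2 hε).ne'
    · intro c t ht htμ δ hδ
      obtain ⟨δ', hδ', hδδ⟩ := exists_Lp_half ℂ μ 1 hδ
      obtain ⟨η, ηpos, hη⟩ :
          ∃ η : ℝ≥0, 0 < η ∧ ∀ s : Set G, μ s ≤ η → eLpNorm (s.indicator fun _ => c) 1 μ ≤ δ' :=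
        exists_eLpNorm_indicator_le ENNReal.one_ne_top c hδ'.ne'
      have hη0 : (η : ℝ≥0∞) ≠ 0 := (ENNReal.coe_pos.2 ηpos).ne'
      obtain ⟨s, st, s_compact, s_closed, μs⟩ := ht.exists_isCompact_isClosed_sdiff_lt htμ.ne hη0
      obtain ⟨V, sV, V_open, -, hV⟩ :=
        s_closed.measurableSet.exists_isOpen_sdiff_lt (μ := μ) s_compact.measure_lt_top.ne hη0
      obtain ⟨k, hk1, hk0, hks, hkr⟩ := exists_continuous_one_zero_of_isCompact s_compact
        V_open.isClosed_compl (Set.disjoint_compl_right_iff_subset.2 sV)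
      have hkc : Continuous fun x => (k x : ℂ) * c := by fun_prop
      refine ⟨fun x => (k x : ℂ) * c, ?_, hkc, (hks.comp_left (g := fun r : ℝ => (r : ℂ))
        (by simp)).mul_right⟩
      have I1 : eLpNorm ((s.indicator fun _ => c) - t.indicator fun _ => c) 1 μ ≤ δ' := by
        rw [← eLpNorm_neg, neg_sub, ← Set.indicator_sdiff st]
        exact hη _ μs.le
      have I2 : eLpNorm ((fun x => (k x : ℂ) * c) - s.indicator fun _ => c) 1 μ ≤ δ' := by
        refine (eLpNorm_mono (g := (V \ s).indicator fun _ => c) fun x => ?_).trans (hη _ hV.le)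
        by_cases hs : x ∈ s
        · simp [hs, hk1 hs]
        · by_cases hv : x ∈ V
          · have h1 := hkr x
            simp only [Pi.sub_apply, hs, not_false_eq_true, Set.indicator_of_notMem, sub_zero,
              norm_mul, Complex.norm_real, Real.norm_of_nonneg h1.1, Set.mem_sdiff, hv, and_self,
              Set.indicator_of_mem]
            exact mul_le_of_le_one_left (norm_nonneg _) h1.2
          · simp [hs, hv, hk0 (show x ∈ Vᶜ from hv)]
      have := (hδδ _ _ (hkc.aestronglyMeasurable.sub
        (aestronglyMeasurable_const.indicator s_closed.measurableSet))
        ((aestronglyMeasurable_const.indicator s_closed.measurableSet).sub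
            (aestronglyMeasurable_const.indicator ht)) I2 I1).le
      simpa only [sub_add_sub_cancel] using this
    · exact fun f g hf hg => ⟨hf.1.add hg.1, hf.2.add hg.2⟩
    · exact fun f hf => hf.1.aestronglyMeasurable
  have hgi : Integrable g μ := hgc.integrable_of_hasCompactSupport hgs
  refine ⟨g, hgs, ?_, hgc, hgi⟩
  rw [eLpNorm_one_eq_lintegral_enorm, ← ofReal_integral_norm_eq_lintegral_enorm (hf.sub hgi)] at hg
  exact (ENNReal.ofReal_le_ofReal_iff hε.le).1 hg

lemma exists_decomposition {f : G → ℂ} (hf : Integrable f μ) :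
    ∃ u : ℕ → G → ℂ, (∀ n, Continuous (u n)) ∧ (∀ n, HasCompactSupport (u n)) ∧
      Summable (fun n => ∫ x, ‖u n x‖ ∂μ) ∧
      ∀ᵐ x ∂μ, Summable (fun n => ‖u n x‖) ∧ HasSum (fun n => u n x) (f x) := by
  have h1 : ∀ n : ℕ, ∃ g : G → ℂ, HasCompactSupport g ∧ (∫ x, ‖f x - g x‖ ∂μ) ≤ (1 / 2) ^ n ∧
      Continuous g ∧ Integrable g μ :=
    fun n => exists_compactSupport_approx μ hf (by positivity)
  choose g hgs hg hgc hgi using h1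
  let w : ℕ → G → ℂ := fun n => Nat.casesOn n 0 g
  have hwc : ∀ n, Continuous (w n) := by
    intro n; cases n with
    | zero => exact continuous_zero
    | succ n => exact hgc n
  have hws : ∀ n, HasCompactSupport (w n) := by
    intro n; cases n with
    | zero => exact HasCompactSupport.zero
    | succ n => exact hgs n
  have hwi : ∀ n, Integrable (w n) μ := fun n => (hwc n).integrable_of_hasCompactSupport (hws n)
  let u : ℕ → G → ℂ := fun n => w (n + 1) - w n
  have huc : ∀ n, Continuous (u n) := fun n => (hwc (n + 1)).sub (hwc n)
  have hus : ∀ n, HasCompactSupport (u n) := fun n => (hws (n + 1)).sub (hws n)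
  have hui : ∀ n, Integrable (u n) μ := fun n => (hwi (n + 1)).sub (hwi n)
  have hsum : Summable (fun n => ∫ x, ‖u n x‖ ∂μ) := by
    rw [← summable_nat_add_iff 1]
    have h2 : Summable fun n : ℕ => (1 / 2 : ℝ) ^ (n + 1) + (1 / 2) ^ n := by
      have := summable_geometric_two
      exact ((summable_nat_add_iff 1).2 this).add this
    refine Summable.of_nonneg_of_le (fun n => integral_nonneg fun _ => norm_nonneg _)
      (fun n => ?_) h2
    have e : ∀ m, Integrable (fun x => ‖f x - g m x‖) μ := fun m => (hf.sub (hgi m)).norm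
    calc ∫ x, ‖u (n + 1) x‖ ∂μ ≤ ∫ x, (‖f x - g (n + 1) x‖ + ‖f x - g n x‖) ∂μ := by
          refine integral_mono (hui _).norm ((e _).add (e _)) fun x => ?_
          show ‖g (n + 1) x - g n x‖ ≤ _
          rw [norm_sub_rev (f x) (g (n + 1) x)]
          exact norm_sub_le_norm_sub_add_norm_sub _ _ _
      _ ≤ _ := by
          rw [integral_add (e _) (e _)]
          exact add_le_add (hg _) (hg _)
  refine ⟨u, huc, hus, hsum, ?_⟩
  have hae : ∀ᵐ x ∂μ, Summable (fun n => ‖u n x‖) := by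
    refine summable_norm_of_tsum_eLpNorm_ne_top le_rfl (fun n => (hui n).1) ?_
    have : ∀ n, eLpNorm (u n) 1 μ = ‖(∫ x, ‖u n x‖ ∂μ)‖ₑ := by
      intro n
      rw [eLpNorm_one_eq_lintegral_enorm, ← ofReal_integral_norm_eq_lintegral_enorm (hui n),
        Real.enorm_of_nonneg (integral_nonneg fun _ => norm_nonneg _)]
    simp_rw [this]
    rw [tsum_enorm_ne_top_iff_summable_norm]
    exact hsum.norm
  have hsub : ∀ᵐ x ∂μ, Summable (fun n => ‖f x - g n x‖) := by
    refine summable_norm_of_tsum_eLpNorm_ne_top (f := fun n x => f x - g n x) le_rfl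
      (fun n => (hf.sub (hgi n)).1) ?_
    have : ∀ n, eLpNorm (fun x => f x - g n x) 1 μ = ‖(∫ x, ‖f x - g n x‖ ∂μ)‖ₑ := by
      intro n
      rw [eLpNorm_one_eq_lintegral_enorm,
        ← ofReal_integral_norm_eq_lintegral_enorm (f := fun x => f x - g n x) (hf.sub (hgi n)),
        Real.enorm_of_nonneg (integral_nonneg fun _ => norm_nonneg _)]
    simp_rw [this]
    rw [tsum_enorm_ne_top_iff_summable_norm]
    refine (Summable.of_nonneg_of_le (fun n => integral_nonneg fun _ => norm_nonneg _)
      hg summable_geometric_two).norm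
  filter_upwards [hae, hsub] with x hx hx'
  refine ⟨hx, ?_⟩
  rw [hx.of_norm.hasSum_iff_tendsto_nat]
  have h3 : ∀ n, ∑ i ∈ Finset.range n, u i x = w n x := by
    intro n
    have := Finset.sum_range_sub (fun i => w i x) n
    simpa [u, w] using this
  simp_rw [h3]
  rw [← tendsto_add_atTop_iff_nat 1]
  have h4 : Tendsto (fun n => f x - g n x) atTop (𝓝 0) :=
    tendsto_zero_iff_norm_tendsto_zero.2 hx'.tendsto_atTop_zero
  have h5 := (tendsto_const_nhds (x := f x)).sub h4
  simpa using h5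

lemma hasCompactSupport_kernel {u v : G → ℂ} (hu' : HasCompactSupport u)
    (hv' : HasCompactSupport v) :
    HasCompactSupport (Function.uncurry fun h x : G => u h * v (h⁻¹ * x)) := by
  refine HasCompactSupport.intro (hu'.isCompact.prod (hu'.isCompact.mul hv'.isCompact)) ?_
  rintro ⟨h, x⟩ hx
  by_contra h0
  simp only [Function.uncurry, ← ne_eq, mul_ne_zero_iff] at h0
  refine hx ⟨subset_tsupport _ h0.1, ?_⟩
  exact ⟨h, subset_tsupport _ h0.1, h⁻¹ * x, subset_tsupport _ h0.2, by simp⟩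

lemma integrable_kernel {u v : G → ℂ} (hu : Continuous u) (hu' : HasCompactSupport u)
    (hv : Continuous v) (x : G) : Integrable (fun h => u h * v (h⁻¹ * x)) μ := by
  refine Continuous.integrable_of_hasCompactSupport (by fun_prop) ?_
  exact hu'.mul_right

lemma integrable_conv_of_compact {u v : G → ℂ} (hu : Continuous u) (hu' : HasCompactSupport u)
    (hv : Continuous v) (hv' : HasCompactSupport v) : Integrable (conv μ u v) μ := by
  refine Continuous.integrable_of_hasCompactSupport ?_ ?_
  · rw [← continuousOn_univ]
    refine continuousOn_integral_of_compact_support hu'.isCompact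
      (f := fun x h => u h * v (h⁻¹ * x)) (by fun_prop) ?_
    intro p x _ hx
    simp [image_eq_zero_of_notMem_tsupport hx]
  · refine HasCompactSupport.intro (hu'.isCompact.mul hv'.isCompact) fun x hx => ?_
    refine integral_eq_zero_of_ae (ae_of_all _ fun h => ?_)
    by_contra h0
    simp only [Pi.zero_apply, ← ne_eq, mul_ne_zero_iff] at h0
    exact hx ⟨h, subset_tsupport _ h0.1, h⁻¹ * x, subset_tsupport _ h0.2, by simp⟩

lemma integral_conv_of_compact {u v : G → ℂ} (hu : Continuous u) (hu' : HasCompactSupport u)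
    (hv : Continuous v) (hv' : HasCompactSupport v) :
    ∫ x, conv μ u v x ∂μ = (∫ x, u x ∂μ) * ∫ x, v x ∂μ := by
  have h1 := integral_integral_swap_of_hasCompactSupport (μ := μ) (ν := μ)
    (f := fun h x : G => u h * v (h⁻¹ * x)) (by simp only [Function.uncurry_def]; fun_prop)
    (hasCompactSupport_kernel hu' hv')
  unfold conv
  rw [← h1]
  simp_rw [integral_const_mul, integral_mul_left_eq_self v]
  rw [integral_mul_const]

lemma hasSum_mul_of_norm {a b : ℕ → ℂ} {s t : ℂ} (ha : Summable fun n => ‖a n‖)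
    (has : HasSum a s) (hb : Summable fun n => ‖b n‖) (hbt : HasSum b t) :
    HasSum (fun p : ℕ × ℕ => a p.1 * b p.2) (s * t) := by
  have h : Summable fun p : ℕ × ℕ => a p.1 * b p.2 := summable_mul_of_summable_norm ha hb
  exact has.mul hbt h

lemma eq_mul_of_hasSum {a b : ℕ → ℂ} {r s t : ℂ}
    (h : HasSum (fun p : ℕ × ℕ => a p.1 * b p.2) r) (has : HasSum a s) (hbt : HasSum b t) :
    r = s * t := h.unique (has.mul hbt h.summable)

theorem conv_main {f g : G → ℂ} (hf : Integrable f μ) (hg : Integrable g μ) :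
    (∀ᵐ x ∂μ, Integrable (fun h => f h * g (h⁻¹ * x)) μ) ∧ Integrable (conv μ f g) μ ∧
      ∫ x, conv μ f g x ∂μ = (∫ x, f x ∂μ) * ∫ x, g x ∂μ := by
  obtain ⟨u, huc, hus, hu, huf⟩ := exists_decomposition μ hf
  obtain ⟨v, hvc, hvs, hv, hvg⟩ := exists_decomposition μ hg
  have hui : ∀ n, Integrable (u n) μ := fun n => (huc n).integrable_of_hasCompactSupport (hus n)
  have hvi : ∀ n, Integrable (v n) μ := fun n => (hvc n).integrable_of_hasCompactSupport (hvs n)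
  -- the convolutions of the absolute values
  let a : ℕ → G → ℂ := fun n x => (‖u n x‖ : ℂ)
  let b : ℕ → G → ℂ := fun n x => (‖v n x‖ : ℂ)
  have hac : ∀ n, Continuous (a n) := fun n => by have := huc n; fun_prop
  have hbc : ∀ n, Continuous (b n) := fun n => by have := hvc n; fun_prop
  have has : ∀ n, HasCompactSupport (a n) := fun n =>
    (hus n).comp_left (g := fun z => ((‖z‖ : ℝ) : ℂ)) (by simp)
  have hbs : ∀ n, HasCompactSupport (b n) := fun n =>
    (hvs n).comp_left (g := fun z => ((‖z‖ : ℝ) : ℂ)) (by simp)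
  have hcv : ∀ (p : ℕ × ℕ) x, conv μ (a p.1) (b p.2) x
      = ((∫ h, ‖u p.1 h * v p.2 (h⁻¹ * x)‖ ∂μ : ℝ) : ℂ) := by
    intro p x
    rw [← integral_complex_ofReal]
    simp [conv, a, b]
  have hci : ∀ p : ℕ × ℕ, Integrable (fun x => ∫ h, ‖u p.1 h * v p.2 (h⁻¹ * x)‖ ∂μ) μ := by
    intro p
    have := (integrable_conv_of_compact μ (hac p.1) (has p.1) (hbc p.2) (hbs p.2)).norm
    refine this.congr (ae_of_all _ fun x => ?_)
    simp only [hcv, Complex.norm_real]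
    exact Real.norm_of_nonneg (integral_nonneg fun _ => norm_nonneg _)
  have hcI : ∀ p : ℕ × ℕ, ∫ x, ∫ h, ‖u p.1 h * v p.2 (h⁻¹ * x)‖ ∂μ ∂μ
      = (∫ x, ‖u p.1 x‖ ∂μ) * ∫ x, ‖v p.2 x‖ ∂μ := by
    intro p
    have := integral_conv_of_compact μ (hac p.1) (has p.1) (hbc p.2) (hbs p.2)
    simp only [hcv, a, b, integral_complex_ofReal] at this
    exact_mod_cast this
  have hS : Summable fun p : ℕ × ℕ => (∫ x, ‖u p.1 x‖ ∂μ) * ∫ x, ‖v p.2 x‖ ∂μ :=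
    Summable.mul_of_nonneg hu hv (fun n => integral_nonneg fun _ => norm_nonneg _)
      (fun n => integral_nonneg fun _ => norm_nonneg _)
  have hae : ∀ᵐ x ∂μ, Summable fun p : ℕ × ℕ => ∫ h, ‖u p.1 h * v p.2 (h⁻¹ * x)‖ ∂μ := by
    have := summable_norm_of_tsum_eLpNorm_ne_top (μ := μ) (p := 1)
      (f := fun (p : ℕ × ℕ) x => ∫ h, ‖u p.1 h * v p.2 (h⁻¹ * x)‖ ∂μ) le_rfl
      (fun p => (hci p).1) ?_
    · filter_upwards [this] with x hx
      exact hx.of_norm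
    · have e : ∀ p : ℕ × ℕ, eLpNorm (fun x => ∫ h, ‖u p.1 h * v p.2 (h⁻¹ * x)‖ ∂μ) 1 μ
          = ‖(∫ x, ‖u p.1 x‖ ∂μ) * ∫ x, ‖v p.2 x‖ ∂μ‖ₑ := by
        intro p
        rw [eLpNorm_one_eq_lintegral_enorm, ← ofReal_integral_norm_eq_lintegral_enorm (hci p),
          ← hcI p, Real.enorm_of_nonneg
            (integral_nonneg fun _ => integral_nonneg fun _ => norm_nonneg _)]
        congr 2
        ext x
        exact Real.norm_of_nonneg (integral_nonneg fun _ => norm_nonneg _)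
      simp_rw [e]
      rw [tsum_enorm_ne_top_iff_summable_norm]
      exact hS.norm
  have hpt : ∀ x, ∀ᵐ h ∂μ,
      HasSum (fun p : ℕ × ℕ => u p.1 h * v p.2 (h⁻¹ * x)) (f h * g (h⁻¹ * x)) := by
    intro x
    have h2 : ∀ᵐ h ∂μ, Summable (fun n => ‖v n (h⁻¹ * x)‖) ∧
        HasSum (fun n => v n (h⁻¹ * x)) (g (h⁻¹ * x)) :=
      (quasiMeasurePreserving_inv_mul μ x).ae hvg
    filter_upwards [huf, h2] with h h3 h4
    exact hasSum_mul_of_norm (a := fun n => u n h) (b := fun n => v n (h⁻¹ * x)) h3.1 h3.2 h4.1 h4.2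
  have hx : ∀ᵐ x ∂μ, Integrable (fun h => f h * g (h⁻¹ * x)) μ ∧
      HasSum (fun p : ℕ × ℕ => conv μ (u p.1) (v p.2) x) (conv μ f g x) := by
    filter_upwards [hae] with x hx
    exact integrable_of_hasSum μ (φ := fun (p : ℕ × ℕ) h => u p.1 h * v p.2 (h⁻¹ * x))
      (Φ := fun h => f h * g (h⁻¹ * x))
      (fun p => integrable_kernel μ (huc p.1) (hus p.1) (hvc p.2) x) hx (hpt x)
  have hle : ∀ p : ℕ × ℕ, ∫ x, ‖conv μ (u p.1) (v p.2) x‖ ∂μ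
      ≤ (∫ x, ‖u p.1 x‖ ∂μ) * ∫ x, ‖v p.2 x‖ ∂μ := by
    intro p
    rw [← hcI p]
    exact integral_mono (integrable_conv_of_compact μ (huc p.1) (hus p.1) (hvc p.2) (hvs p.2)).norm
      (hci p) fun x => norm_integral_le_integral_norm _
  have hfin := integrable_of_hasSum μ (φ := fun p : ℕ × ℕ => conv μ (u p.1) (v p.2))
    (fun p => integrable_conv_of_compact μ (huc p.1) (hus p.1) (hvc p.2) (hvs p.2))
    (Summable.of_nonneg_of_le (fun p => integral_nonneg fun _ => norm_nonneg _) hle hS)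
    (hx.mono fun x h => h.2)
  refine ⟨hx.mono fun x h => h.1, hfin.1, ?_⟩
  have e0 : ∀ p : ℕ × ℕ, ∫ x, conv μ (u p.1) (v p.2) x ∂μ
      = (∫ x, u p.1 x ∂μ) * ∫ x, v p.2 x ∂μ :=
    fun p => integral_conv_of_compact μ (huc p.1) (hus p.1) (hvc p.2) (hvs p.2)
  have e1 := hfin.2
  simp only [e0] at e1
  have e2 := (integrable_of_hasSum μ hui hu (huf.mono fun x h => h.2)).2
  have e3 := (integrable_of_hasSum μ hvi hv (hvg.mono fun x h => h.2)).2
  exact eq_mul_of_hasSum (a := fun n => ∫ x, u n x ∂μ) (b := fun n => ∫ x, v n x ∂μ) e1 e2 e3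

lemma conv_congr {f f' g g' : G → ℂ} (hf : f =ᵐ[μ] f') (hg : g =ᵐ[μ] g') :
    conv μ f g = conv μ f' g' := by
  ext x
  refine integral_congr_ae ?_
  have h2 : ∀ᵐ h ∂μ, g (h⁻¹ * x) = g' (h⁻¹ * x) := (quasiMeasurePreserving_inv_mul μ x).ae hg
  filter_upwards [hf, h2] with h h3 h4
  rw [h3, h4]

lemma integral_norm_conv_le {f g : G → ℂ} (hf : Integrable f μ) (hg : Integrable g μ) :
    ∫ x, ‖conv μ f g x‖ ∂μ ≤ (∫ x, ‖f x‖ ∂μ) * ∫ x, ‖g x‖ ∂μ := by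
  obtain ⟨-, h1, h2⟩ := conv_main μ (f := fun x => ((‖f x‖ : ℝ) : ℂ))
    (g := fun x => ((‖g x‖ : ℝ) : ℂ)) hf.norm.ofReal hg.norm.ofReal
  have h3 : ∀ x, conv μ (fun x => ((‖f x‖ : ℝ) : ℂ)) (fun x => ((‖g x‖ : ℝ) : ℂ)) x
      = ((∫ h, ‖f h * g (h⁻¹ * x)‖ ∂μ : ℝ) : ℂ) := by
    intro x
    rw [← integral_complex_ofReal]
    simp [conv]
  have h4 : Integrable (fun x => ∫ h, ‖f h * g (h⁻¹ * x)‖ ∂μ) μ := by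
    have := h1.re
    simpa [h3] using this
  have h5 : ∫ x, ∫ h, ‖f h * g (h⁻¹ * x)‖ ∂μ ∂μ = (∫ x, ‖f x‖ ∂μ) * ∫ x, ‖g x‖ ∂μ := by
    simp only [h3, integral_complex_ofReal] at h2
    exact_mod_cast h2
  rw [← h5]
  exact integral_mono (conv_main μ hf hg).2.1.norm h4 fun x => norm_integral_le_integral_norm _

lemma conv_assoc_of_compact {u v w : G → ℂ} (hu : Continuous u) (hu' : HasCompactSupport u)
    (hv : Continuous v) (hv' : HasCompactSupport v) (hw : Continuous w) :
    conv μ (conv μ u v) w = conv μ u (conv μ v w) := by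
  ext x
  have h1 := integral_integral_swap_of_hasCompactSupport (μ := μ) (ν := μ)
    (f := fun k h : G => u h * v (h⁻¹ * k) * w (k⁻¹ * x))
    (by simp only [Function.uncurry_def]; fun_prop) (by
      refine HasCompactSupport.intro
        ((hu'.isCompact.mul hv'.isCompact).prod hu'.isCompact) ?_
      rintro ⟨k, h⟩ hx
      by_contra h0
      simp only [Function.uncurry, ← ne_eq, mul_ne_zero_iff] at h0
      refine hx ⟨⟨h, subset_tsupport _ h0.1.1, h⁻¹ * k, subset_tsupport _ h0.1.2, by simp⟩,
        subset_tsupport _ h0.1.1⟩)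
  have h2 : ∀ h : G, ∫ k, u h * v (h⁻¹ * k) * w (k⁻¹ * x) ∂μ
      = u h * ∫ k, v k * w (k⁻¹ * (h⁻¹ * x)) ∂μ := by
    intro h
    rw [← integral_mul_left_eq_self (fun k => u h * v (h⁻¹ * k) * w (k⁻¹ * x)) h,
      ← integral_const_mul]
    congr 1; ext k
    simp [mul_assoc]
  simp only [h2] at h1
  simp only [conv, ← integral_mul_const]
  exact h1

/-- The involution `f*(x) = Δ(x⁻¹) conj (f (x⁻¹))`. -/
noncomputable def involution (f : G → ℂ) (x : G) : ℂ :=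
  ((modularFunction x⁻¹ : ℝ) : ℂ) * starRingEnd ℂ (f x⁻¹)

lemma involution_congr {f g : G → ℂ} (h : f =ᵐ[μ] g) : involution f =ᵐ[μ] involution g := by
  have h2 : ∀ᵐ x ∂μ, f x⁻¹ = g x⁻¹ := (quasiMeasurePreserving_inv μ).ae h
  filter_upwards [h2] with x hx
  rw [involution, involution, hx]

lemma involution_involution (f : G → ℂ) : involution (involution f) = f := by
  ext x
  have : ((modularFunction x⁻¹ : ℝ) : ℂ) * ((modularFunction x : ℝ) : ℂ) = 1 := by
    rw [mul_comm, ← Complex.ofReal_mul, ← NNReal.coe_mul, modularFunction_mul_inv]; simp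
  simp only [involution, inv_inv, map_mul, Complex.conj_ofReal, Complex.conj_conj]
  rw [← mul_assoc, this, one_mul]

lemma lintegral_enorm_involution {f : G → ℂ} (hf : Integrable f μ) :
    ∫⁻ x, ‖involution f x‖ₑ ∂μ = ∫⁻ x, ‖f x‖ₑ ∂μ := by
  have h1 : f =ᵐ[μ] hf.1.mk f := hf.1.ae_eq_mk
  have h2 := involution_congr μ h1
  rw [lintegral_congr_ae (h2.mono fun x hx => by rw [hx]),
    lintegral_congr_ae (h1.mono fun x hx => show ‖f x‖ₑ = ‖hf.1.mk f x‖ₑ by rw [← hx])]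
  have h3 : ∫⁻ x, ‖hf.1.mk f x‖ₑ ∂μ ≠ ∞ := by
    rw [← lintegral_congr_ae (h1.mono fun x hx => show ‖f x‖ₑ = ‖hf.1.mk f x‖ₑ by rw [← hx])]
    exact hf.2.ne
  rw [← lintegral_inv_mul_modularFunction μ hf.1.stronglyMeasurable_mk.enorm h3]
  refine lintegral_congr fun x => ?_
  rw [involution, enorm_mul, mul_comm]
  congr 1
  · simp [enorm, nnnorm]
  · simp [enorm, nnnorm]

lemma integrable_involution {f : G → ℂ} (hf : Integrable f μ) : Integrable (involution f) μ := by
  refine ⟨?_, ?_⟩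
  · have h1 : AEStronglyMeasurable (fun x => f x⁻¹) μ :=
      hf.1.comp_quasiMeasurePreserving (quasiMeasurePreserving_inv μ)
    have h2 : Continuous fun x : G => ((modularFunction x⁻¹ : ℝ) : ℂ) := by
      have := continuous_modularFunction (G := G)
      fun_prop
    exact h2.aestronglyMeasurable.mul (Complex.continuous_conj.comp_aestronglyMeasurable h1)
  · rw [hasFiniteIntegral_iff_enorm, lintegral_enorm_involution μ hf]
    exact hf.2

lemma involution_conv (f g : G → ℂ) :
    involution (conv μ f g) = conv μ (involution g) (involution f) := by
  ext x
  have e : conv μ (involution g) (involution f) x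
      = ∫ h, involution g (x * h) * involution f ((x * h)⁻¹ * x) ∂μ :=
    (integral_mul_left_eq_self (fun h => involution g h * involution f (h⁻¹ * x)) x).symm
  rw [e]
  simp only [involution, conv]
  rw [← integral_conj, ← integral_const_mul]
  congr 1; ext k
  have h : ((modularFunction k⁻¹ : ℝ) : ℂ) * ((modularFunction k : ℝ) : ℂ) = 1 := by
    rw [mul_comm, ← Complex.ofReal_mul, ← NNReal.coe_mul, modularFunction_mul_inv]; simp
  simp only [mul_inv_rev, inv_inv, map_mul, modularFunction_mul, NNReal.coe_mul,
    Complex.ofReal_mul, inv_mul_cancel_right]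
  linear_combination (-((modularFunction x⁻¹ : ℝ) : ℂ) * starRingEnd ℂ (f k) *
    starRingEnd ℂ (g (k⁻¹ * x⁻¹))) * h

end functions

end GroupL1

/-- The space `L¹(G)` of classes of functions integrable for the left Haar measure `μ`. -/
def GroupL1 {G : Type*} [MeasurableSpace G] (μ : Measure G) : Type _ := Lp ℂ 1 μ

namespace GroupL1

noncomputable instance {G : Type*} [MeasurableSpace G] (μ : Measure G) :
    NormedAddCommGroup (GroupL1 μ) := inferInstanceAs (NormedAddCommGroup (Lp ℂ 1 μ))

noncomputable instance {G : Type*} [MeasurableSpace G] (μ : Measure G) :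
    NormedSpace ℂ (GroupL1 μ) := inferInstanceAs (NormedSpace ℂ (Lp ℂ 1 μ))

instance {G : Type*} [MeasurableSpace G] (μ : Measure G) :
    CompleteSpace (GroupL1 μ) := inferInstanceAs (CompleteSpace (Lp ℂ 1 μ))

/-- A representative of a class. -/
noncomputable def rep {G : Type*} [MeasurableSpace G] {μ : Measure G} (F : GroupL1 μ) : G → ℂ :=
  (show Lp ℂ 1 μ from F : G → ℂ)

/-- The class of an integrable function. -/
noncomputable def mk {G : Type*} [MeasurableSpace G] {μ : Measure G} (f : G → ℂ)
    (hf : Integrable f μ) : GroupL1 μ := hf.toL1 f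

lemma integrable_rep {G : Type*} [MeasurableSpace G] {μ : Measure G} (F : GroupL1 μ) :
    Integrable (rep F) μ := L1.integrable_coeFn _

lemma rep_mk {G : Type*} [MeasurableSpace G] {μ : Measure G} {f : G → ℂ} (hf : Integrable f μ) :
    rep (mk f hf) =ᵐ[μ] f := hf.coeFn_toL1

lemma mk_rep {G : Type*} [MeasurableSpace G] {μ : Measure G} (F : GroupL1 μ) :
    mk (rep F) (integrable_rep F) = F := Integrable.toL1_coeFn _ _

lemma mk_eq_mk {G : Type*} [MeasurableSpace G] {μ : Measure G} {f g : G → ℂ}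
    (hf : Integrable f μ) (hg : Integrable g μ) : mk f hf = mk g hg ↔ f =ᵐ[μ] g :=
  Integrable.toL1_eq_toL1_iff _ _ _ _

lemma mk_add {G : Type*} [MeasurableSpace G] {μ : Measure G} {f g : G → ℂ}
    (hf : Integrable f μ) (hg : Integrable g μ) :
    mk f hf + mk g hg = mk (f + g) (hf.add hg) := (Integrable.toL1_add _ _ _ _).symm

lemma mk_sub {G : Type*} [MeasurableSpace G] {μ : Measure G} {f g : G → ℂ}
    (hf : Integrable f μ) (hg : Integrable g μ) :
    mk f hf - mk g hg = mk (f - g) (hf.sub hg) := (Integrable.toL1_sub _ _ _ _).symm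

lemma smul_mk {G : Type*} [MeasurableSpace G] {μ : Measure G} {f : G → ℂ}
    (hf : Integrable f μ) (c : ℂ) : c • mk f hf = mk (c • f) (hf.smul c) :=
  (Integrable.toL1_smul _ _ _).symm

lemma norm_mk {G : Type*} [MeasurableSpace G] {μ : Measure G} {f : G → ℂ}
    (hf : Integrable f μ) : ‖mk f hf‖ = ∫ x, ‖f x‖ ∂μ := L1.norm_of_fun_eq_integral_norm hf

variable {G : Type*} [Group G] [TopologicalSpace G] [IsTopologicalGroup G]
  [LocallyCompactSpace G] [MeasurableSpace G] [BorelSpace G] {μ : Measure G}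
  [μ.IsHaarMeasure] [μ.Regular]

/-- Multiplication in `L¹(G)` is convolution. -/
noncomputable instance : Mul (GroupL1 μ) :=
  ⟨fun F H => mk (conv μ (rep F) (rep H)) (conv_main μ (integrable_rep F) (integrable_rep H)).2.1⟩

/-- The involution of `L¹(G)`. -/
noncomputable instance : Star (GroupL1 μ) :=
  ⟨fun F => mk (involution (rep F)) (integrable_involution μ (integrable_rep F))⟩

lemma mk_mul_mk {f g : G → ℂ} (hf : Integrable f μ) (hg : Integrable g μ) :
    mk f hf * mk g hg = mk (conv μ f g) (conv_main μ hf hg).2.1 := by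
  refine (mk_eq_mk _ _).2 ?_
  rw [conv_congr μ (rep_mk hf) (rep_mk hg)]

lemma star_mk {f : G → ℂ} (hf : Integrable f μ) :
    star (mk f hf) = mk (involution f) (integrable_involution μ hf) :=
  (mk_eq_mk _ _).2 (involution_congr μ (rep_mk hf))

lemma exists_mk (F : GroupL1 μ) : ∃ (f : G → ℂ) (hf : Integrable f μ), F = mk f hf :=
  ⟨_, integrable_rep F, (mk_rep F).symm⟩

protected lemma mul_add (A B C : GroupL1 μ) : A * (B + C) = A * B + A * C := by
  obtain ⟨f, hf, rfl⟩ := exists_mk A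
  obtain ⟨g, hg, rfl⟩ := exists_mk B
  obtain ⟨k, hk, rfl⟩ := exists_mk C
  simp only [mk_add, mk_mul_mk, mk_eq_mk]
  filter_upwards [(conv_main μ hf hg).1, (conv_main μ hf hk).1] with x h1 h2
  simp only [conv, Pi.add_apply, mul_add]
  exact integral_add h1 h2

protected lemma add_mul (A B C : GroupL1 μ) : (A + B) * C = A * C + B * C := by
  obtain ⟨f, hf, rfl⟩ := exists_mk A
  obtain ⟨g, hg, rfl⟩ := exists_mk B
  obtain ⟨k, hk, rfl⟩ := exists_mk C
  simp only [mk_add, mk_mul_mk, mk_eq_mk]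
  filter_upwards [(conv_main μ hf hk).1, (conv_main μ hg hk).1] with x h1 h2
  simp only [conv, Pi.add_apply, add_mul]
  exact integral_add h1 h2

protected lemma smul_mul (c : ℂ) (A B : GroupL1 μ) : (c • A) * B = c • (A * B) := by
  obtain ⟨f, hf, rfl⟩ := exists_mk A
  obtain ⟨g, hg, rfl⟩ := exists_mk B
  simp only [smul_mk, mk_mul_mk, mk_eq_mk]
  refine ae_of_all _ fun x => ?_
  simp only [conv, Pi.smul_apply, smul_eq_mul, mul_assoc]
  exact integral_const_mul _ _

protected lemma mul_smul (c : ℂ) (A B : GroupL1 μ) : A * (c • B) = c • (A * B) := by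
  obtain ⟨f, hf, rfl⟩ := exists_mk A
  obtain ⟨g, hg, rfl⟩ := exists_mk B
  simp only [smul_mk, mk_mul_mk, mk_eq_mk]
  refine ae_of_all _ fun x => ?_
  simp only [conv, Pi.smul_apply, smul_eq_mul, mul_left_comm _ c]
  exact integral_const_mul _ _

protected lemma norm_mul_le' (A B : GroupL1 μ) : ‖A * B‖ ≤ ‖A‖ * ‖B‖ := by
  obtain ⟨f, hf, rfl⟩ := exists_mk A
  obtain ⟨g, hg, rfl⟩ := exists_mk B
  rw [mk_mul_mk, norm_mk, norm_mk, norm_mk]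
  exact integral_norm_conv_le μ hf hg

lemma continuous_mul' : Continuous fun p : GroupL1 μ × GroupL1 μ => p.1 * p.2 := by
  let B : GroupL1 μ →L[ℂ] GroupL1 μ →L[ℂ] GroupL1 μ :=
    LinearMap.mkContinuous₂ (LinearMap.mk₂ ℂ (fun A B : GroupL1 μ => A * B)
      GroupL1.add_mul GroupL1.smul_mul GroupL1.mul_add
      (fun c A B => GroupL1.mul_smul c A B)) 1
      (fun A B => by simpa using GroupL1.norm_mul_le' A B)
  exact B.continuous₂

lemma denseRange_compactSupport :
    DenseRange fun u : {u : G → ℂ // Continuous u ∧ HasCompactSupport u} =>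
      (mk u.1 (u.2.1.integrable_of_hasCompactSupport u.2.2) : GroupL1 μ) := by
  refine Metric.denseRange_iff.2 fun F r hr => ?_
  obtain ⟨f, hf, rfl⟩ := exists_mk F
  obtain ⟨g, hg, hfg, hgc, -⟩ := exists_compactSupport_approx μ hf (half_pos hr)
  refine ⟨⟨g, hgc, hg⟩, ?_⟩
  rw [dist_eq_norm, mk_sub, norm_mk]
  exact lt_of_le_of_lt hfg (half_lt_self hr)

protected lemma mul_assoc (A B C : GroupL1 μ) : A * B * C = A * (B * C) := by
  have hc := continuous_mul' (μ := μ)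
  have h1 : Continuous fun q : GroupL1 μ × GroupL1 μ × GroupL1 μ => q.1 * q.2.1 * q.2.2 :=
    hc.comp ((hc.comp (continuous_fst.prodMk (continuous_fst.comp continuous_snd))).prodMk
      (continuous_snd.comp continuous_snd))
  have h2 : Continuous fun q : GroupL1 μ × GroupL1 μ × GroupL1 μ => q.1 * (q.2.1 * q.2.2) :=
    hc.comp (continuous_fst.prodMk (hc.comp continuous_snd))
  refine isClosed_property3 (p := fun A B C : GroupL1 μ => A * B * C = A * (B * C))
    denseRange_compactSupport (isClosed_eq h1 h2) ?_ A B C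
  rintro ⟨u, hu, hu'⟩ ⟨v, hv, hv'⟩ ⟨w, hw, hw'⟩
  simp only [mk_mul_mk, mk_eq_mk]
  rw [conv_assoc_of_compact μ hu hu' hv hv' hw]

/-- `L¹(G)` is a Banach algebra under convolution. -/
noncomputable instance : NonUnitalNormedRing (GroupL1 μ) where
  __ := (inferInstance : NormedAddCommGroup (GroupL1 μ))
  left_distrib := GroupL1.mul_add
  right_distrib := GroupL1.add_mul
  zero_mul A := by
    have := GroupL1.add_mul (0 : GroupL1 μ) 0 A
    rwa [add_zero, left_eq_add] at this
  mul_zero A := by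
    have := GroupL1.mul_add A (0 : GroupL1 μ) 0
    rwa [add_zero, left_eq_add] at this
  mul_assoc := GroupL1.mul_assoc
  norm_mul_le := GroupL1.norm_mul_le'

instance : IsScalarTower ℂ (GroupL1 μ) (GroupL1 μ) := ⟨GroupL1.smul_mul⟩

instance : SMulCommClass ℂ (GroupL1 μ) (GroupL1 μ) :=
  ⟨fun c A B => (GroupL1.mul_smul c A B).symm⟩

noncomputable instance : StarRing (GroupL1 μ) where
  star_involutive A := by
    obtain ⟨f, hf, rfl⟩ := exists_mk A
    simp only [star_mk, involution_involution]
  star_mul A B := by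
    obtain ⟨f, hf, rfl⟩ := exists_mk A
    obtain ⟨g, hg, rfl⟩ := exists_mk B
    simp only [star_mk, mk_mul_mk, involution_conv]
  star_add A B := by
    obtain ⟨f, hf, rfl⟩ := exists_mk A
    obtain ⟨g, hg, rfl⟩ := exists_mk B
    simp only [star_mk, mk_add, mk_eq_mk]
    refine ae_of_all _ fun x => ?_
    simp [involution, mul_add]

instance : StarModule ℂ (GroupL1 μ) where
  star_smul c A := by
    obtain ⟨f, hf, rfl⟩ := exists_mk A
    simp only [star_mk, smul_mk, mk_eq_mk]
    refine ae_of_all _ fun x => ?_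
    simp [involution, mul_left_comm]

instance : NormedStarGroup (GroupL1 μ) where
  norm_star_le A := by
    obtain ⟨f, hf, rfl⟩ := exists_mk A
    rw [star_mk, norm_mk, norm_mk, integral_norm_eq_lintegral_enorm (integrable_involution μ hf).1,
      integral_norm_eq_lintegral_enorm hf.1, lintegral_enorm_involution μ hf]


/-- A (not necessarily unital) complex algebra element has real spectrum.  `quasispectrum ℂ a` is
the spectrum of `a` in the unitization; it differs from the spectrum of `a` at most in the
real number `0`. -/
def HasRealSpectrum {A : Type*} [NonUnitalRing A] [Module ℂ A] (a : A) : Prop :=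
  ∀ z ∈ quasispectrum ℂ a, z.im = 0

/-- `G`, with left Haar measure `μ`, is Hermitian: every selfadjoint element of the Banach
`*`-algebra `L¹(G)` has real spectrum. -/
def IsHermitianGroup (μ : Measure G) [μ.IsHaarMeasure] [μ.Regular] : Prop :=
  ∀ a : GroupL1 μ, IsSelfAdjoint a → HasRealSpectrum a

/-- The growth rate `limsup μ(Sⁿ)^{1/n}` of `S`. -/
noncomputable def growthRate (μ : Measure G) (S : Set G) : ℝ≥0∞ :=
  limsup (fun n : ℕ => μ (S ^ n) ^ (1 / (n : ℝ))) atTop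

/-- The function `Δ^{-1/2}`. -/
noncomputable def invSqrtModular (x : G) : ℝ := (modularFunction x : ℝ) ^ (-(1 / 2) : ℝ)

/-- The function `(∫_S Δ^{-1/2} dμ)⁻¹ Δ^{-1/2} χ_S`. -/
noncomputable def normalizedWeight (μ : Measure G) (S : Set G) (x : G) : ℂ :=
  (((∫ h in S, invSqrtModular h ∂μ)⁻¹ * S.indicator invSqrtModular x : ℝ) : ℂ)

end GroupL1

/-! ### Small monic polynomials in an element with real spectrum. -/

section BanachAlgebra

open Polynomial

variable {A : Type*} [NormedRing A] [NormedAlgebra ℂ A] [CompleteSpace A]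

/-! Let `f` be the normalised weight, suppose its spectrum is real, and play the capacity of an
interval against the growth of `S`. Since `‖f‖ ≤ 1`, the spectrum lies in `[-1, 1]`, a set of
capacity `1/2`. Hence for every `θ > 1/2` there are monic polynomials `Q` of each degree `n + 1` for
which the `L¹` part of `Q(f)` has norm at most `C θ ^ n` (`exists_monic_norm_sum_nonunitalPow_le`).
This `1/2` is the source of the factor `2` in the hypothesis on the growth rate.

That part is the `(n + 1)`-st convolution power of `f` plus a combination of lower powers, and the
lower powers vanish outside `S, …, S ^ n`. On the new part of `S ^ (n + 1)`, the points in none of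
these sets, only the top power survives. With `b = inf_S f`, the relation `S * K ⊆ S` bounds it
below there by `b (μ(K) b) ^ n` (`le_realConvPow`). Markov's inequality then gives the new part
measure at most `D ρ ^ n`, where `θ = ρ μ(K) b` (`exists_measure_pow_sdiff_le`). The condition `θ >
1/2` says exactly that `ρ` exceeds the threshold in the hypothesis, so `ρ` can be chosen between
that threshold and the growth rate.

If `ρ < 1`, the new parts have finite total measure, so the subgroup generated by `S` has finite
measure. It contains `K`, hence is open by Steinhaus' theorem, hence compact, a contradiction. If `ρ
≥ 1`, adding up the new parts gives `μ(S ^ n) ≤ D n ρ ^ n`, so the growth rate is at most `ρ`, again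
a contradiction.

Selfadjointness plays no role in this estimate; it only turns the nonreal spectrum of `f` into the
failure of the Hermitian property. -/

lemma exists_norm_pow_le_of_spectralRadius_lt (b : A) {t : ℝ} (ht : 0 < t)
    (hb : spectralRadius ℂ b < ENNReal.ofReal t) : ∃ C : ℝ, ∀ k : ℕ, ‖b ^ k‖ ≤ C * t ^ k := by
  have h1 : ∀ᶠ k : ℕ in atTop, ‖b ^ k‖ / t ^ k ≤ 1 := by
    filter_upwards [(spectrum.pow_norm_pow_one_div_tendsto_nhds_spectralRadius b).eventually_lt_const
      hb, eventually_gt_atTop 0] with k hk hk0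
    have h2 := (ENNReal.ofReal_lt_ofReal_iff ht).1 hk
    have hk' : (k : ℝ) ≠ 0 := by positivity
    have h3 : ‖b ^ k‖ ≤ t ^ k := by
      have := pow_le_pow_left₀ (by positivity) h2.le k
      rwa [← Real.rpow_natCast (_ ^ (_ : ℝ)), ← Real.rpow_mul (norm_nonneg _),
        one_div_mul_cancel hk', Real.rpow_one] at this
    exact div_le_one_of_le₀ h3 (by positivity)
  obtain ⟨C, hC⟩ := (isBoundedUnder_of_eventually_le h1).bddAbove_range
  exact ⟨C, fun k => (div_le_iff₀ (by positivity)).1 (hC ⟨k, rfl⟩)⟩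

lemma norm_eval_T_ofReal_le_one (m : ℕ) {x : ℝ} (hx : |x| ≤ 1) :
    ‖(Chebyshev.T ℂ m).eval (x : ℂ)‖ ≤ 1 := by
  have h : (Chebyshev.T ℂ m).eval (x : ℂ) = (((Chebyshev.T ℝ m).eval x : ℝ) : ℂ) := by
    rw [← Chebyshev.map_T Complex.ofRealHom, ← Complex.ofRealHom_eq_coe, eval_map_apply]
    rfl
  rw [h, Complex.norm_real]
  exact Chebyshev.abs_eval_T_real_le_one m hx

/-- The interval `[-1, 1]` has capacity `1 / 2`. -/
lemma exists_monic_norm_aeval_le (a : A)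
    (ha : ∀ z ∈ spectrum ℂ a, ∃ x : ℝ, |x| ≤ 1 ∧ z = x) {θ : ℝ} (hθ : 1 / 2 < θ) :
    ∃ C : ℝ, ∀ n : ℕ, ∃ Q : ℂ[X], Q.Monic ∧ Q.natDegree = n ∧ ‖aeval a Q‖ ≤ C * θ ^ n := by
  have hθ0 : 0 < θ := by linarith
  obtain ⟨j, hj⟩ := pow_unbounded_of_one_lt 2 (show 1 < 2 * θ by linarith)
  -- The inequality amounts to `2 < (2θ) ^ m`. Here `2 ^ (m - 1)` is the leading coefficient of the
  -- Chebyshev polynomial `T_m`, so the monic rescaling of `T_m` is at most `(1/2) ^ (m - 1)` on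
  -- `[-1, 1]`.
  obtain ⟨m, hm0, hm⟩ : ∃ m : ℕ, 0 < m ∧ (1 / 2) ^ (m - 1) < θ ^ m := by
    refine ⟨j + 1, j.succ_pos, ?_⟩
    have h2 : 2 < (2 * θ) ^ (j + 1) :=
      hj.trans_le (pow_le_pow_right₀ (by linarith) j.le_succ)
    rw [mul_pow, pow_succ 2 j] at h2
    rw [Nat.add_sub_cancel, one_div, inv_pow, inv_lt_iff_one_lt_mul₀ (by positivity)]
    linarith
  let P : ℂ[X] := C ((1 / 2) ^ (m - 1)) * Chebyshev.T ℂ m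
  have hc : ((1 / 2 : ℂ) ^ (m - 1)) ≠ 0 := pow_ne_zero _ (by norm_num)
  have hPdeg : P.natDegree = m := by
    rw [natDegree_C_mul hc, Chebyshev.natDegree_T]; simp
  have hPmon : P.Monic := by
    rw [Monic, leadingCoeff_mul, leadingCoeff_C, Chebyshev.leadingCoeff_T, Int.natAbs_natCast, ← mul_pow]
    simp
  have hrad : spectralRadius ℂ (aeval a P) < ENNReal.ofReal (θ ^ m) := by
    refine lt_of_le_of_lt (b := ENNReal.ofReal ((1 / 2) ^ (m - 1))) ?_
      ((ENNReal.ofReal_lt_ofReal_iff (by positivity)).2 hm)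
    -- Spectral mapping: every point of the spectrum of `P(a)` is a value of `P` on `[-1, 1]`.
    refine iSup₂_le fun z hz => ?_
    rw [spectrum.map_polynomial_aeval_of_degree_pos a P
      (natDegree_pos_iff_degree_pos.1 (hPdeg ▸ hm0))] at hz
    obtain ⟨w, hw, rfl⟩ := hz
    obtain ⟨x, hx, rfl⟩ := ha w hw
    rw [← enorm_eq_nnnorm, ← ofReal_norm]
    refine ENNReal.ofReal_le_ofReal ?_
    simp only [P, eval_mul, eval_C, norm_mul, norm_pow]
    simpa using mul_le_of_le_one_right (a := ((2 : ℝ) ^ (m - 1))⁻¹) (by positivity)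
      (norm_eval_T_ofReal_le_one m hx)
  obtain ⟨C₀, hC₀⟩ := exists_norm_pow_le_of_spectralRadius_lt _ (by positivity) hrad
  refine ⟨(∑ r ∈ Finset.range m, ‖a ^ r‖ / θ ^ r) * C₀, fun n => ?_⟩
  -- Powers of `P` only reach degrees divisible by `m`. The factor `X ^ (n % m)` supplies the
  -- others, and its finitely many possible norms are absorbed into the constant.
  refine ⟨X ^ (n % m) * P ^ (n / m), (monic_X_pow _).mul (hPmon.pow _), ?_, ?_⟩
  · rw [(monic_X_pow _).natDegree_mul (hPmon.pow _), natDegree_X_pow, hPmon.natDegree_pow, hPdeg,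
      mul_comm, Nat.mod_add_div]
  · have hC₀0 : 0 ≤ C₀ := by
      have := (norm_nonneg _).trans (hC₀ 0)
      simpa using this
    have hle : ‖a ^ (n % m)‖ / θ ^ (n % m) ≤ ∑ r ∈ Finset.range m, ‖a ^ r‖ / θ ^ r :=
      Finset.single_le_sum (f := fun r => ‖a ^ r‖ / θ ^ r) (fun r _ => by positivity)
        (Finset.mem_range.2 (Nat.mod_lt n hm0))
    rw [map_mul, map_pow, map_pow, aeval_X]
    calc ‖a ^ (n % m) * aeval a P ^ (n / m)‖
        ≤ ‖a ^ (n % m)‖ * (C₀ * (θ ^ m) ^ (n / m)) :=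
          (norm_mul_le _ _).trans (by gcongr; exact hC₀ _)
      _ = ‖a ^ (n % m)‖ / θ ^ (n % m) * C₀ * θ ^ n := by
          conv_rhs => rw [← Nat.mod_add_div n m, pow_add, pow_mul]
          simp only [Nat.add_mul_mod_self_left, Nat.mod_mod]
          field_simp
      _ ≤ _ := by gcongr

/-- The powers `a, a * a, a * (a * a), …` in a non-unital algebra. -/
def nonunitalPow {R : Type*} [Mul R] (a : R) : ℕ → R
  | 0 => a
  | n + 1 => a * nonunitalPow a n

lemma inr_pow_succ {R : Type*} [NonUnitalRing R] [Module ℂ R] [IsScalarTower ℂ R R]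
    [SMulCommClass ℂ R R] (a : R) (n : ℕ) :
    (a : Unitization ℂ R) ^ (n + 1) = (nonunitalPow a n : R) := by
  induction n with
  | zero => simp [nonunitalPow]
  | succ n ih => rw [pow_succ', ih, nonunitalPow, Unitization.inr_mul]

/-- The constant term of `Q` lives only in the scalar component of the unitization. Dropping that
component leaves an honest element of `R`, whose `k`-th term is the `(k + 1)`-st power. -/
lemma snd_aeval_inr {R : Type*} [NonUnitalRing R] [Module ℂ R] [IsScalarTower ℂ R R]
    [SMulCommClass ℂ R R] (a : R) (Q : ℂ[X]) :
    (aeval (a : Unitization ℂ R) Q).snd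
      = ∑ k ∈ Finset.range Q.natDegree, Q.coeff (k + 1) • nonunitalPow a k := by
  rw [aeval_eq_sum_range, Finset.sum_range_succ', Unitization.snd_add, pow_zero]
  have : ∀ (s : Finset ℕ) (φ : ℕ → Unitization ℂ R), (∑ k ∈ s, φ k).snd = ∑ k ∈ s, (φ k).snd :=
    fun s φ => _root_.map_sum (Unitization.sndHom ℂ ℂ R) φ s
  simp [this, inr_pow_succ]

/-- Capacity bound for an algebra that may lack a unit, such as `L¹(G)`. The unitization carries the
`ℓ¹` norm: `a` keeps its norm there, and the component in `R` is bounded by the whole norm. -/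
lemma exists_monic_norm_sum_nonunitalPow_le {R : Type*} [NonUnitalNormedRing R] [NormedSpace ℂ R]
    [IsScalarTower ℂ R R] [SMulCommClass ℂ R R] [CompleteSpace R] (a : R) (ha1 : ‖a‖ ≤ 1)
    (ha : GroupL1.HasRealSpectrum a) {θ : ℝ} (hθ : 1 / 2 < θ) :
    ∃ C : ℝ, ∀ n : ℕ, ∃ Q : ℂ[X], Q.Monic ∧ Q.natDegree = n + 1 ∧
      ‖∑ k ∈ Finset.range (n + 1), Q.coeff (k + 1) • nonunitalPow a k‖ ≤ C * θ ^ n := by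
  let e := WithLp.unitizationAlgEquiv (𝕜 := ℂ) (A := R) ℂ
  have he : e (e.symm (a : Unitization ℂ R)) = a := e.apply_symm_apply _
  have hspec : spectrum ℂ (e.symm (a : Unitization ℂ R)) = quasispectrum ℂ a := by
    rw [Unitization.quasispectrum_eq_spectrum_inr, AlgEquiv.spectrum_eq]
  -- The spectrum is bounded by `‖a‖ * ‖1‖`, so `‖1‖ = 1` is what confines it to `[-1, 1]`.
  have hone : ‖(1 : WithLp 1 (Unitization ℂ R))‖ = 1 := by
    rw [WithLp.unitization_norm_def]
    have : WithLp.ofLp (1 : WithLp 1 (Unitization ℂ R)) = 1 := rfl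
    simp [this]
  have hnorm : ‖e.symm (a : Unitization ℂ R)‖ ≤ 1 := by
    have := WithLp.unitization_norm_inr (𝕜 := ℂ) a
    exact this.trans_le ha1
  obtain ⟨C, hC⟩ := exists_monic_norm_aeval_le (e.symm (a : Unitization ℂ R)) (fun z hz => by
    have hz0 : z.im = 0 := ha z (hspec ▸ hz)
    have hz' : z = (z.re : ℂ) := Complex.ext (by simp) (by simp [hz0])
    refine ⟨z.re, ?_, hz'⟩
    have := spectrum.norm_le_norm_mul_of_mem hz
    rw [hone, mul_one] at this
    exact (Complex.abs_re_le_norm z).trans (this.trans hnorm)) hθ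
  -- The polynomial has degree `n + 1`; the extra factor `θ` goes into the constant.
  refine ⟨C * θ, fun n => ?_⟩
  obtain ⟨Q, hQ, hQn, hQC⟩ := hC (n + 1)
  refine ⟨Q, hQ, hQn, ?_⟩
  rw [← hQn, ← snd_aeval_inr]
  have h1 : WithLp.ofLp (aeval (e.symm (a : Unitization ℂ R)) Q)
      = aeval (a : Unitization ℂ R) Q := by
    have := aeval_algHom_apply e.toAlgHom (e.symm (a : Unitization ℂ R)) Q
    rw [show e.toAlgHom (e.symm (a : Unitization ℂ R)) = a from he] at this
    exact this.symm
  rw [WithLp.unitization_norm_def, h1, pow_succ', ← mul_assoc] at hQC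
  exact (le_add_of_nonneg_left (norm_nonneg _)).trans hQC

end BanachAlgebra

/-! ### Convolution powers: support, lower bound and measure of the new part of a power. -/

namespace GroupL1

/-- Inverting `S * K ⊆ S` gives `K⁻¹ * S ⊆ S` by symmetry of `S`, and only the first factor of a
product in `S ^ (n + 1)` is affected. -/
lemma inv_mul_mem_pow {G : Type*} [Group G] {S K : Set G} (hinv : S⁻¹ = S) (hSK : S * K ⊆ S) (n : ℕ) {k y : G}
    (hk : k ∈ K) (hy : y ∈ S ^ (n + 1)) : k⁻¹ * y ∈ S ^ (n + 1) := by
  rw [pow_succ'] at hy ⊢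
  obtain ⟨s, hs, t, ht, rfl⟩ := hy
  refine ⟨k⁻¹ * s, ?_, t, ht, by simp [mul_assoc]⟩
  rw [← hinv, Set.mem_inv, mul_inv_rev, inv_inv]
  exact hSK ⟨s⁻¹, by rwa [← Set.mem_inv, hinv], k, hk, rfl⟩

section convolutionPowers

variable {G : Type*} [Group G] [TopologicalSpace G] [IsTopologicalGroup G]
  [LocallyCompactSpace G] [MeasurableSpace G] [BorelSpace G] (μ : Measure G)

/-- The convolution powers `φ, φ * φ, …` of a real function. -/
noncomputable def realConvPow (φ : G → ℝ) : ℕ → G → ℝ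
  | 0 => φ
  | n + 1 => fun x => ∫ h, φ h * realConvPow φ n (h⁻¹ * x) ∂μ

lemma conv_ofReal {G : Type*} [Group G] [MeasurableSpace G] (μ : Measure G) (φ ψ : G → ℝ) :
    conv μ (fun x => (φ x : ℂ)) (fun x => (ψ x : ℂ))
      = fun x => ((∫ h, φ h * ψ (h⁻¹ * x) ∂μ : ℝ) : ℂ) := by
  ext x
  rw [← integral_complex_ofReal]
  simp [conv]

/-- If `h` and `h⁻¹ * x` both lie in the supports, then `x` is their product. The vanishing holds at
every point, because the convolution powers are actual functions and not classes. -/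
lemma realConvPow_eq_zero {G : Type*} [Group G] [MeasurableSpace G] (μ : Measure G) {φ : G → ℝ} {S : Set G} (hφ : ∀ x ∉ S, φ x = 0) (n : ℕ) :
    ∀ x ∉ S ^ (n + 1), realConvPow μ φ n x = 0 := by
  induction n with
  | zero => simpa [realConvPow] using hφ
  | succ n ih =>
    intro x hx
    refine integral_eq_zero_of_ae (ae_of_all _ fun h => ?_)
    by_cases hh : h ∈ S
    · have h1 : h⁻¹ * x ∉ S ^ (n + 1) := fun h2 => hx (by
        rw [pow_succ']
        exact ⟨h, hh, h⁻¹ * x, h2, by simp⟩)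
      simp [ih _ h1]
    · simp [hφ h hh]

variable [μ.IsHaarMeasure] [μ.Regular]

lemma integrable_realConvPow {φ : G → ℝ} (hφ : Integrable φ μ) (n : ℕ) :
    Integrable (realConvPow μ φ n) μ := by
  induction n with
  | zero => exact hφ
  | succ n ih =>
    have h := (conv_main μ (f := fun x => (φ x : ℂ))
      (g := fun x => (realConvPow μ φ n x : ℂ)) hφ.ofReal ih.ofReal).2.1
    have h2 := (conv_ofReal μ φ (realConvPow μ φ n) ▸ h).re
    exact h2

lemma nonunitalPow_mk {φ : G → ℝ} (hφ : Integrable φ μ) (n : ℕ) :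
    nonunitalPow (mk (fun x => (φ x : ℂ)) hφ.ofReal) n
      = mk (fun x => (realConvPow μ φ n x : ℂ)) (integrable_realConvPow μ hφ n).ofReal := by
  induction n with
  | zero => rfl
  | succ n ih =>
    rw [nonunitalPow, ih, mk_mul_mk, mk_eq_mk, conv_ofReal]
    rfl

lemma sum_smul_mk {ι : Type*} (s : Finset ι) (c : ι → ℂ) (f : ι → G → ℂ)
    (hf : ∀ i, Integrable (f i) μ) :
    ∑ i ∈ s, c i • mk (f i) (hf i)
      = mk (fun x => ∑ i ∈ s, c i * f i x)
        (integrable_finsetSum s fun i _ => (hf i).const_mul (c i)) := by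
  classical
  induction s using Finset.induction_on with
  | empty =>
    simp only [Finset.sum_empty]
    exact (Integrable.toL1_zero _).symm
  | insert i s hi ih =>
    rw [Finset.sum_insert hi, ih, smul_mk, mk_add, mk_eq_mk]
    refine ae_of_all _ fun x => ?_
    simp [Finset.sum_insert hi]

lemma integrable_mul_comp_inv_mul {φ ψ : G → ℝ} (hφ : Integrable φ μ)
    (hψ : AEStronglyMeasurable ψ μ) {M : ℝ} (hM : ∀ x, |ψ x| ≤ M) (x : G) :
    Integrable (fun h => φ h * ψ (h⁻¹ * x)) μ :=
  hφ.mul_bdd (hψ.comp_quasiMeasurePreserving (quasiMeasurePreserving_inv_mul μ x))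
    (ae_of_all _ fun _ => hM _)

/-- Averaging against a nonnegative function of mass at most `1` preserves the bounds. They make the
next convolution integrand integrable for every `x`, so no lower bound is lost to the default value
`0` of a divergent integral. -/
lemma realConvPow_mem_Icc {φ : G → ℝ} (hφ : Integrable φ μ) (h0 : ∀ x, 0 ≤ φ x) {M : ℝ}
    (hM : ∀ x, φ x ≤ M) (h1 : ∫ x, φ x ∂μ ≤ 1) (n : ℕ) (x : G) :
    realConvPow μ φ n x ∈ Set.Icc 0 M := by
  induction n generalizing x with
  | zero => exact ⟨h0 x, hM x⟩
  | succ n ih =>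
    refine ⟨integral_nonneg fun h => mul_nonneg (h0 h) (ih _).1, ?_⟩
    have hM0 : 0 ≤ M := (h0 x).trans (hM x)
    calc ∫ h, φ h * realConvPow μ φ n (h⁻¹ * x) ∂μ ≤ ∫ h, φ h * M ∂μ := by
          refine integral_mono (integrable_mul_comp_inv_mul μ hφ
            (integrable_realConvPow μ hφ n).1 (M := M) (fun y => ?_) x) (hφ.mul_const M)
            fun h => mul_le_mul_of_nonneg_left (ih _).2 (h0 h)
          exact abs_le.2 ⟨by linarith [(ih y).1], (ih y).2⟩
      _ ≤ M := by
          rw [integral_mul_const]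
          exact mul_le_of_le_one_left hM0 h1

/-- At `x = s * y`, the values `h = s * k` with `k ∈ K` already suffice: `s * k` stays in `S` and
`k⁻¹ * y` stays in the same power of `S` as `y`. Each convolution therefore gains a factor `μ(K) b`.
-/
lemma le_realConvPow {φ : G → ℝ} (hφ : Integrable φ μ) (h0 : ∀ x, 0 ≤ φ x) {M : ℝ}
    (hM : ∀ x, φ x ≤ M) (h1 : ∫ x, φ x ∂μ ≤ 1) {S K : Set G} (hinv : S⁻¹ = S)
    (hSK : S * K ⊆ S) (hK : MeasurableSet K) (hKfin : μ K ≠ ∞) {b : ℝ} (hb : 0 ≤ b)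
    (hbφ : ∀ x ∈ S, b ≤ φ x) (n : ℕ) :
    ∀ x ∈ S ^ (n + 1), b * (μ.real K * b) ^ n ≤ realConvPow μ φ n x := by
  induction n with
  | zero => simpa [realConvPow] using hbφ
  | succ n ih =>
    intro x hx
    rw [pow_succ'] at hx
    obtain ⟨s, hs, y, hy, rfl⟩ := hx
    have hIcc := realConvPow_mem_Icc μ hφ h0 hM h1 n
    have hint := integrable_mul_comp_inv_mul μ hφ (integrable_realConvPow μ hφ n).1 (M := M)
      (fun y => abs_le.2 ⟨by linarith [(hIcc y).1, (hIcc y).2], (hIcc y).2⟩) (s * y)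
    show _ ≤ ∫ h, φ h * realConvPow μ φ n (h⁻¹ * (s * y)) ∂μ
    rw [← integral_mul_left_eq_self _ s]
    calc b * (μ.real K * b) ^ (n + 1)
        = ∫ h, K.indicator (fun _ => b * (b * (μ.real K * b) ^ n)) h ∂μ := by
          rw [integral_indicator_const _ hK, smul_eq_mul]
          ring
      _ ≤ _ := by
          refine integral_mono ((integrable_indicator_iff hK).2
            (integrableOn_const hKfin)) (hint.comp_mul_left s) fun h => ?_
          by_cases hh : h ∈ K
          · rw [Set.indicator_of_mem hh]
            have e : (s * h)⁻¹ * (s * y) = h⁻¹ * y := by group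
            rw [e]
            exact mul_le_mul (hbφ _ (hSK ⟨s, hs, h, hh, rfl⟩))
              (ih _ (inv_mul_mem_pow hinv hSK n hh hy)) (by positivity) (h0 _)
          · rw [Set.indicator_of_notMem hh]
            exact mul_nonneg (h0 _) (hIcc _).1

/-- If a convolution power of `φ` is bounded below on `Sⁿ⁺¹` and the spectrum of `φ` is real, the
part of `Sⁿ⁺¹` outside of the smaller powers of `S` is controlled. -/
lemma exists_measure_pow_sdiff_le {φ : G → ℝ} (hφ : Integrable φ μ) (h0 : ∀ x, 0 ≤ φ x) {M : ℝ}
    (hM : ∀ x, φ x ≤ M) (h1 : ∫ x, φ x ∂μ ≤ 1) {S K : Set G} (hφS : ∀ x ∉ S, φ x = 0)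
    (hinv : S⁻¹ = S) (hSK : S * K ⊆ S) (hK : MeasurableSet K) (hKfin : μ K ≠ ∞) (hKpos : 0 < μ K)
    {b : ℝ} (hb : 0 < b) (hbφ : ∀ x ∈ S, b ≤ φ x)
    (hreal : HasRealSpectrum (mk (μ := μ) (fun x => (φ x : ℂ)) hφ.ofReal))
    {ρ : ℝ} (hρ : 1 / 2 < ρ * (μ.real K * b)) :
    ∃ D : ℝ, 0 < D ∧ ∀ n : ℕ,
      μ (S ^ (n + 1) \ ⋃ j < n, S ^ (j + 1)) ≤ ENNReal.ofReal (D * ρ ^ n) := by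
  have hK0 : 0 < μ.real K := ENNReal.toReal_pos hKpos.ne' hKfin
  have hρ0 : 0 < ρ := 
    (pos_iff_pos_of_mul_pos (lt_trans (by norm_num) hρ)).2 (by positivity)
  have hnorm : ‖mk (μ := μ) (fun x => (φ x : ℂ)) hφ.ofReal‖ ≤ 1 := by
    rw [norm_mk]
    simpa [abs_of_nonneg (h0 _)] using h1
  -- Applied with `θ = ρ μ(K) b`, so that division by the lower bound `b (μ(K) b) ^ n` leaves `C / b
  -- * ρ ^ n`. Replacing `C` by `|C| + 1` makes the constant positive.
  obtain ⟨C, hC⟩ := exists_monic_norm_sum_nonunitalPow_le _ hnorm hreal hρ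
  refine ⟨(|C| + 1) / b, by positivity, fun n => ?_⟩
  obtain ⟨Q, hQ, hQn, hQC⟩ := hC n
  rw [Finset.sum_congr rfl fun k _ => congrArg (Q.coeff (k + 1) • ·) (nonunitalPow_mk μ hφ k)]
    at hQC
  rw [sum_smul_mk μ _ _ (fun k x => (realConvPow μ φ k x : ℂ))
    (fun k => (integrable_realConvPow μ hφ k).ofReal), norm_mk] at hQC
  set F : G → ℂ := fun x => ∑ k ∈ Finset.range (n + 1), Q.coeff (k + 1) * realConvPow μ φ k x
    with hF
  have hFi : Integrable F μ := integrable_finsetSum _ fun k _ =>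
    (integrable_realConvPow μ hφ k).ofReal.const_mul _
  set β : ℝ := b * (μ.real K * b) ^ n with hβ
  have hβ0 : 0 < β := by positivity
  -- On the new part every lower convolution power vanishes, and the top one has coefficient `1`
  -- because `Q` is monic.
  have hsub : S ^ (n + 1) \ ⋃ j < n, S ^ (j + 1) ⊆ {x | β ≤ ‖F x‖} := by
    rintro x ⟨hx, hx'⟩
    simp only [Set.mem_iUnion, not_exists] at hx'
    have e : F x = (realConvPow μ φ n x : ℂ) := by
      have hlead : Q.coeff (n + 1) = 1 := hQn ▸ hQ.coeff_natDegree
      rw [hF]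
      simp only [Finset.sum_range_succ, hlead, one_mul, add_eq_right]
      refine Finset.sum_eq_zero fun k hk => ?_
      rw [realConvPow_eq_zero μ hφS k x (hx' k (Finset.mem_range.1 hk))]
      simp
    show β ≤ ‖F x‖
    rw [e, Complex.norm_real]
    exact (le_realConvPow μ hφ h0 hM h1 hinv hSK hK hKfin hb.le hbφ n x hx).trans
      (le_abs_self _)
  have hmarkov := mul_meas_ge_le_integral_of_nonneg (μ := μ) (ae_of_all _ fun x => norm_nonneg (F x))
    hFi.norm β
  have hfin : μ {x | β ≤ ‖F x‖} ≠ ∞ := (hFi.norm.measure_ge_lt_top hβ0).ne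
  refine (measure_mono hsub).trans ?_
  rw [← ENNReal.ofReal_toReal hfin]
  refine ENNReal.ofReal_le_ofReal ?_
  have h2 : β * μ.real {x | β ≤ ‖F x‖} ≤ β * ((|C| + 1) / b * ρ ^ n) := by
    refine (hmarkov.trans hQC).trans ?_
    calc C * (ρ * (μ.real K * b)) ^ n ≤ (|C| + 1) * (ρ * (μ.real K * b)) ^ n := by
          gcongr
          linarith [le_abs_self C]
      _ = _ := by
          rw [hβ, mul_pow ρ]
          field_simp
  exact le_of_mul_le_mul_left h2 hβ0

end convolutionPowers

end GroupL1

/-! ### Generated subgroups and Haar measure. -/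

lemma Subgroup.closure_subset_iUnion_pow {G : Type*} [Group G] {S : Set G} (hS : S.Nonempty) (hinv : S⁻¹ = S) :
    (Subgroup.closure S : Set G) ⊆ ⋃ k : ℕ, S ^ (k + 1) := by
  intro x hx
  induction hx using Subgroup.closure_induction with
  | mem x hx => exact Set.mem_iUnion.2 ⟨0, by simpa using hx⟩
  | one =>
    obtain ⟨s, hs⟩ := hS
    -- The union starts at `S ^ 1` and `S` need not contain `1`, so the identity is found in `S ^ 2`
    -- as `s * s⁻¹`.
    refine Set.mem_iUnion.2 ⟨1, ?_⟩
    rw [one_add_one_eq_two, sq]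
    exact ⟨s, hs, s⁻¹, by rwa [← Set.mem_inv, hinv], by simp⟩
  | mul x y _ _ hx hy =>
    obtain ⟨m, hm⟩ := Set.mem_iUnion.1 hx
    obtain ⟨n, hn⟩ := Set.mem_iUnion.1 hy
    refine Set.mem_iUnion.2 ⟨m + n + 1, ?_⟩
    rw [show m + n + 1 + 1 = (m + 1) + (n + 1) by ring, pow_add]
    exact Set.mul_mem_mul hm hn
  | inv x _ hx =>
    obtain ⟨m, hm⟩ := Set.mem_iUnion.1 hx
    refine Set.mem_iUnion.2 ⟨m, ?_⟩
    rwa [← Set.mem_inv, ← inv_pow, hinv]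

section Topology

variable {G : Type*} [Group G] [TopologicalSpace G] [IsTopologicalGroup G]
  [LocallyCompactSpace G] [MeasurableSpace G] [BorelSpace G] (μ : Measure G) [μ.IsHaarMeasure]

/-- An open subgroup of finite Haar measure is compact. -/
lemma Subgroup.isCompact_of_isOpen_of_haar_ne_top (H : Subgroup G) (hH : IsOpen (H : Set G))
    (hμ : μ H ≠ ∞) : IsCompact (H : Set G) := by
  have hemb : IsOpenEmbedding H.subtype := hH.isOpenEmbedding_subtypeVal
  have : LocallyCompactSpace H := hH.locallyCompactSpace
  have : (μ.comap H.subtype).IsHaarMeasure := IsHaarMeasure.comap (mH := inferInstance) μ hemb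
  by_contra hc
  have : NoncompactSpace H := by
    rw [← not_compactSpace_iff]
    exact fun h => hc (isCompact_iff_compactSpace.2 h)
  -- The restriction of `μ` to `H` is a Haar measure, and a noncompact group has infinite Haar
  -- measure.
  have h1 := measure_univ_of_isMulLeftInvariant (μ.comap H.subtype)
  rw [hemb.measurableEmbedding.comap_apply] at h1
  refine hμ ?_
  simpa using h1

/-- Steinhaus: for a measurable `E ⊆ K` of full measure in `K`, the set `E / E` is a neighbourhood
of `1`, and it lies in `H`. -/
lemma Subgroup.isOpen_of_haar_pos [μ.Regular] (H : Subgroup G) {K : Set G}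
    (hKm : NullMeasurableSet K μ) (hK : 0 < μ K) (hKfin : μ K ≠ ∞) (hKH : K ⊆ H) :
    IsOpen (H : Set G) := by
  obtain ⟨E, hEK, hE, hEae⟩ := hKm.exists_measurable_subset_ae_eq
  have hμ : μ E = μ K := measure_congr hEae
  refine H.isOpen_of_mem_nhds (g := 1) (mem_of_superset
    (div_mem_nhds_one_of_haar_pos_ne_top μ E hE (hμ ▸ hK) (hμ ▸ hKfin)) ?_)
  rintro _ ⟨x, hx, y, hy, rfl⟩
  exact H.div_mem (hKH (hEK hx)) (hKH (hEK hy))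

end Topology

/-! ### From the measures of the new parts to the growth rate. -/

section Growth

/-- Both `D ^ (1/n)` and `n ^ (1/n)` tend to `1`, so a linear factor does not affect the rate. -/
lemma limsup_rpow_one_div_le {a : ℕ → ℝ≥0∞} {ρ D : ℝ} (hD : 0 < D) (hρ : 0 ≤ ρ)
    (h : ∀ n : ℕ, 0 < n → a n ≤ ENNReal.ofReal (D * n * ρ ^ n)) :
    limsup (fun n : ℕ => a n ^ (1 / (n : ℝ))) atTop ≤ ENNReal.ofReal ρ := by
  have h1 : Tendsto (fun n : ℕ => D ^ (1 / (n : ℝ)) * (n : ℝ) ^ (1 / (n : ℝ)) * ρ) atTop (𝓝 ρ) := by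
    have e1 : Tendsto (fun n : ℕ => D ^ (1 / (n : ℝ))) atTop (𝓝 1) := by
      have := (Real.continuousAt_const_rpow (b := 0) hD.ne').tendsto.comp
        (tendsto_one_div_atTop_nhds_zero_nat (𝕜 := ℝ))
      rwa [Real.rpow_zero] at this
    have e2 : Tendsto (fun n : ℕ => (n : ℝ) ^ (1 / (n : ℝ))) atTop (𝓝 1) :=
      tendsto_rpow_div.comp tendsto_natCast_atTop_atTop
    simpa using (e1.mul e2).mul_const ρ
  have h2 := ENNReal.tendsto_ofReal h1
  rw [← h2.limsup_eq]
  refine limsup_le_limsup ?_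
  filter_upwards [eventually_gt_atTop 0] with n hn
  have hn' : (n : ℝ) ≠ 0 := by positivity
  calc a n ^ (1 / (n : ℝ)) ≤ ENNReal.ofReal (D * n * ρ ^ n) ^ (1 / (n : ℝ)) :=
        ENNReal.rpow_le_rpow (h n hn) (by positivity)
    _ = _ := by
        rw [ENNReal.ofReal_rpow_of_nonneg (by positivity) (by positivity),
          Real.mul_rpow (by positivity) (by positivity), Real.mul_rpow hD.le (by positivity),
          ← Real.rpow_natCast ρ n, ← Real.rpow_mul hρ, mul_one_div_cancel hn', Real.rpow_one]

/-- Each point is assigned to the least index at which it appears. No monotonicity is needed, which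
matters because the powers of `S` need not be nested. -/
lemma iUnion_subset_iUnion_sdiff {α : Type*} (s : ℕ → Set α) (n : ℕ) :
    s n ⊆ ⋃ k ∈ Finset.range (n + 1), s k \ ⋃ j < k, s j := by
  classical
  intro x hx
  have hex : ∃ k, x ∈ s k := ⟨n, hx⟩
  refine Set.mem_iUnion₂.2 ⟨Nat.find hex, Finset.mem_range.2
    (Nat.lt_succ_of_le (Nat.find_min' hex hx)), Nat.find_spec hex, ?_⟩
  simp only [Set.mem_iUnion, not_exists]
  exact fun j hj => Nat.find_min hex hj

variable {α : Type*} [MeasurableSpace α] (μ : Measure α)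

lemma measure_iUnion_ne_top_of_sdiff_le {s : ℕ → Set α} {ρ D : ℝ} (hD : 0 ≤ D) (hρ : 0 ≤ ρ)
    (hρ1 : ρ < 1) (h : ∀ n, μ (s n \ ⋃ j < n, s j) ≤ ENNReal.ofReal (D * ρ ^ n)) :
    μ (⋃ n, s n) ≠ ∞ := by
  have h1 : (⋃ n, s n) ⊆ ⋃ n, s n \ ⋃ j < n, s j := Set.iUnion_subset fun n =>
    (iUnion_subset_iUnion_sdiff s n).trans
      (Set.iUnion₂_subset fun k _ => Set.subset_iUnion (fun n => s n \ ⋃ j < n, s j) k)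
  refine ne_top_of_le_ne_top ?_ ((measure_mono h1).trans
    ((measure_iUnion_le _).trans (ENNReal.tsum_le_tsum h)))
  rw [← ENNReal.ofReal_tsum_of_nonneg (fun n => by positivity)
    ((summable_geometric_of_lt_one hρ hρ1).mul_left D)]
  exact ENNReal.ofReal_ne_top

/-- For `ρ ≥ 1` each of the `n + 1` pieces is bounded by the last term. The exponent is raised to `n
+ 1` to match the index of `S ^ (n + 1)`. -/
lemma measure_le_of_sdiff_le {s : ℕ → Set α} {ρ D : ℝ} (hD : 0 ≤ D) (hρ : 1 ≤ ρ)
    (h : ∀ n, μ (s n \ ⋃ j < n, s j) ≤ ENNReal.ofReal (D * ρ ^ n)) (n : ℕ) :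
    μ (s n) ≤ ENNReal.ofReal (D * (n + 1 : ℕ) * ρ ^ (n + 1)) := by
  have hρ0 : 0 ≤ ρ := by linarith
  calc μ (s n) ≤ ∑ k ∈ Finset.range (n + 1), μ (s k \ ⋃ j < k, s j) :=
        (measure_mono (iUnion_subset_iUnion_sdiff s n)).trans (measure_biUnion_finset_le _ _)
    _ ≤ ∑ k ∈ Finset.range (n + 1), ENNReal.ofReal (D * ρ ^ (n + 1)) := by
        refine Finset.sum_le_sum fun k hk => (h k).trans (ENNReal.ofReal_le_ofReal ?_)
        have := (Finset.mem_range.1 hk).le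
        gcongr
    _ = _ := by
        rw [Finset.sum_const, Finset.card_range, ← ENNReal.ofReal_nsmul, nsmul_eq_mul]
        congr 1
        ring

end Growth

/-! ### The weight `Δ^{-1/2}`. -/

namespace GroupL1

section weights

variable {G : Type*} [Group G] [TopologicalSpace G] [IsTopologicalGroup G]
  [LocallyCompactSpace G]

lemma invSqrtModular_pos (x : G) : 0 < invSqrtModular x :=
  Real.rpow_pos_of_pos (modularFunction_pos x) _

/-- The exponent `-1/2` is the one for which `Δ(x⁻¹) w(x⁻¹) = w(x)`; this makes the weight on a
symmetric set invariant under the involution. -/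
lemma modularFunction_inv_mul_invSqrtModular_inv (x : G) :
    (modularFunction x⁻¹ : ℝ) * invSqrtModular x⁻¹ = invSqrtModular x := by
  have hpos : (0 : ℝ) < modularFunction x := modularFunction_pos x
  have hinv : (modularFunction x⁻¹ : ℝ) = (modularFunction x : ℝ)⁻¹ :=
    eq_inv_of_mul_eq_one_right (by exact_mod_cast modularFunction_mul_inv x)
  rw [invSqrtModular, invSqrtModular, hinv, Real.inv_rpow hpos.le, ← Real.rpow_neg hpos.le,
    ← Real.rpow_neg_one, ← Real.rpow_add hpos]
  norm_num

lemma involution_normalizedWeight [MeasurableSpace G] (μ : Measure G) {S : Set G} (hinv : S⁻¹ = S) :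
    involution (normalizedWeight μ S) = normalizedWeight μ S := by
  have hmem : ∀ x, x⁻¹ ∈ S ↔ x ∈ S := fun x => by rw [← Set.mem_inv, hinv]
  ext x
  rw [involution, normalizedWeight, normalizedWeight, Complex.conj_ofReal, ← Complex.ofReal_mul]
  congr 1
  by_cases hx : x ∈ S
  · rw [Set.indicator_of_mem hx, Set.indicator_of_mem ((hmem x).2 hx), mul_left_comm,
      modularFunction_inv_mul_invSqrtModular_inv]
  · rw [Set.indicator_of_notMem hx, Set.indicator_of_notMem (mt (hmem x).1 hx)]
    ring

variable [MeasurableSpace G] [BorelSpace G]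

lemma continuous_invSqrtModular : Continuous (invSqrtModular : G → ℝ) :=
  (NNReal.continuous_coe.comp continuous_modularFunction).rpow_const
    fun x => Or.inl (ne_of_gt (modularFunction_pos x))

variable (μ : Measure G) [μ.IsHaarMeasure] {S : Set G}

lemma integrable_indicator_invSqrtModular (hSm : NullMeasurableSet S μ)
    (hSc : IsCompact (closure S)) : Integrable (S.indicator invSqrtModular) μ :=
  ((continuous_invSqrtModular.locallyIntegrable.integrableOn_isCompact hSc).mono_set
    subset_closure).integrable_indicator₀ hSm

lemma setIntegral_invSqrtModular_pos (hSm : NullMeasurableSet S μ)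
    (hSc : IsCompact (closure S)) (hS : 0 < μ S) : 0 < ∫ h in S, invSqrtModular h ∂μ := by
  rw [← integral_indicator₀ hSm, integral_pos_iff_support_of_nonneg
    (Set.indicator_nonneg fun x _ => (invSqrtModular_pos x).le)
    (integrable_indicator_invSqrtModular μ hSm hSc), Set.support_indicator,
    Set.inter_eq_left.2 (show S ⊆ Function.support fun x => invSqrtModular x from
      fun x _ => (invSqrtModular_pos x).ne')]
  exact hS

/-- The continuous positive weight attains its minimum on the compact closure of `S`. -/
lemma iInf_invSqrtModular_pos (hSc : IsCompact (closure S)) (hS : S.Nonempty) :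
    0 < ⨅ h : S, invSqrtModular (h : G) := by
  have : Nonempty S := hS.to_subtype
  obtain ⟨x, -, hx⟩ := hSc.exists_isMinOn hS.closure continuous_invSqrtModular.continuousOn
  exact (invSqrtModular_pos x).trans_le (le_ciInf fun h => hx (subset_closure h.2))

end weights

end GroupL1

/-! ### The main theorem. -/

open GroupL1 in
theorem mainTheorem1 {G : Type*} [Group G] [TopologicalSpace G] [IsTopologicalGroup G]
    [LocallyCompactSpace G] [MeasurableSpace G] [BorelSpace G]
    (μ : Measure G) [μ.IsHaarMeasure] [μ.Regular] (S K : Set G)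
    (hSm : NullMeasurableSet S μ) (hSc : IsCompact (closure S)) (hSsymm : S⁻¹ = S)
    (hSgen : ¬ IsCompact (Subgroup.closure S : Set G))
    (hKm : NullMeasurableSet K μ) (hKc : IsCompact (closure K)) (hKpos : 0 < μ K)
    (hSK : S * K ⊆ S)
    (hω : ENNReal.ofReal ((∫ h in S, GroupL1.invSqrtModular h ∂μ) /
        (2 * μ.real K * ⨅ h : S, GroupL1.invSqrtModular (h : G))) < GroupL1.growthRate μ S) :
    ¬ GroupL1.IsHermitianGroup μ ∧
      ∃ hf : Integrable (GroupL1.normalizedWeight μ S) μ,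
        IsSelfAdjoint (GroupL1.mk (GroupL1.normalizedWeight μ S) hf) ∧
        ¬ GroupL1.HasRealSpectrum (GroupL1.mk (GroupL1.normalizedWeight μ S) hf) := by
  have hSne : S.Nonempty := by
    rw [Set.nonempty_iff_ne_empty]
    rintro rfl
    simp at hSgen
  obtain ⟨s, hs⟩ := hSne
  have hsK : ∀ k ∈ K, s * k ∈ S := fun k hk => hSK ⟨s, hs, k, hk, rfl⟩
  have hKfin : μ K ≠ ∞ := ne_top_of_le_ne_top hKc.measure_lt_top.ne (measure_mono subset_closure)
  -- `S` contains the translate `s K`.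
  have hSpos : 0 < μ S := by
    rw [← measure_smul μ s] at hKpos
    refine hKpos.trans_le (measure_mono ?_)
    rintro _ ⟨k, hk, rfl⟩
    exact hsK k hk
  set I := ∫ h in S, invSqrtModular h ∂μ with hI
  set α := ⨅ h : S, invSqrtModular (h : G) with hα
  have hI0 : 0 < I := setIntegral_invSqrtModular_pos μ hSm hSc hSpos
  have hα0 : 0 < α := iInf_invSqrtModular_pos hSc ⟨s, hs⟩
  let φ : G → ℝ := fun x => I⁻¹ * S.indicator invSqrtModular x
  have hφ : Integrable φ μ := (integrable_indicator_invSqrtModular μ hSm hSc).const_mul _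
  have hf : Integrable (normalizedWeight μ S) μ := hφ.ofReal
  have hsa : IsSelfAdjoint (GroupL1.mk (normalizedWeight μ S) hf) := by
    rw [IsSelfAdjoint, star_mk, mk_eq_mk, involution_normalizedWeight μ hSsymm]
  suffices hns : ¬ HasRealSpectrum (GroupL1.mk (normalizedWeight μ S) hf) from
    ⟨fun h => hns (h _ hsa), hf, hsa, hns⟩
  intro hreal
  have hφ0 : ∀ x, 0 ≤ φ x := fun x => mul_nonneg (inv_nonneg.2 hI0.le)
    (Set.indicator_nonneg (fun y _ => (invSqrtModular_pos y).le) x)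
  have hφS : ∀ x ∉ S, φ x = 0 := fun x hx => by simp [φ, hx]
  obtain ⟨M, hM⟩ : ∃ M, ∀ x, φ x ≤ M := by
    obtain ⟨B, hB⟩ := hSc.bddAbove_image (f := invSqrtModular)
      continuous_invSqrtModular.continuousOn
    have hB' : ∀ x ∈ S, invSqrtModular x ≤ B := fun x hx => hB ⟨x, subset_closure hx, rfl⟩
    have hB0 : 0 ≤ B := (invSqrtModular_pos s).le.trans (hB' s hs)
    exact ⟨I⁻¹ * B, fun x => mul_le_mul_of_nonneg_left
      (Set.indicator_le' (g := fun _ => B) hB' (fun _ _ => hB0) x) (inv_nonneg.2 hI0.le)⟩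
  have hφ1 : ∫ x, φ x ∂μ ≤ 1 := by
    rw [integral_const_mul, integral_indicator₀ hSm, inv_mul_cancel₀ hI0.ne']
  -- This fixes the lower bound `b = α / I`, so that `1 / (2 μ(K) b)` is the threshold of the
  -- hypothesis.
  have hbφ : ∀ x ∈ S, α / I ≤ φ x := fun x hx => by
    simp only [φ, Set.indicator_of_mem hx, div_eq_inv_mul]
    refine mul_le_mul_of_nonneg_left ?_ (inv_nonneg.2 hI0.le)
    exact ciInf_le (f := fun h : S => invSqrtModular (h : G))
      ⟨0, by rintro _ ⟨y, rfl⟩; exact (invSqrtModular_pos _).le⟩ ⟨x, hx⟩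
  -- `K` is only null measurable. A measurable subset of the same measure still satisfies `S * E ⊆
  -- S`.
  obtain ⟨E, hEK, hE, hEae⟩ := hKm.exists_measurable_subset_ae_eq
  have hμE : μ E = μ K := measure_congr hEae
  have hK0 : 0 < μ.real K := ENNReal.toReal_pos hKpos.ne' hKfin
  obtain ⟨ρ, hρ0, hρ, hρω⟩ := ENNReal.lt_iff_exists_real_btwn.1 hω
  have hρ' : 1 / 2 < ρ * (μ.real E * (α / I)) := by
    have h1 := (ENNReal.ofReal_lt_ofReal_iff_of_nonneg (by positivity)).1 hρ
    rw [div_lt_iff₀ (by positivity)] at h1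
    rw [show μ.real E = μ.real K by rw [measureReal_def, hμE, measureReal_def],
      show ρ * (μ.real K * (α / I)) = ρ * μ.real K * α / I by ring, lt_div_iff₀ hI0]
    linarith
  obtain ⟨D, hD, hdiff⟩ := exists_measure_pow_sdiff_le μ hφ hφ0 hM hφ1 hφS hSsymm
    ((Set.mul_subset_mul_left hEK).trans hSK) hE (hμE ▸ hKfin) (hμE ▸ hKpos)
    (div_pos hα0 hI0) hbφ hreal hρ'
  rcases lt_or_ge ρ 1 with hρ1 | hρ1
  · have hHfin : μ (Subgroup.closure S : Set G) ≠ ∞ :=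
      ne_top_of_le_ne_top (measure_iUnion_ne_top_of_sdiff_le μ hD.le hρ0 hρ1 hdiff)
        (measure_mono (Subgroup.closure_subset_iUnion_pow ⟨s, hs⟩ hSsymm))
    -- Write `k = s⁻¹ * (s * k)` with `s * k ∈ S`.
    have hKH : K ⊆ Subgroup.closure S := fun k hk => by
      have := (Subgroup.closure S).mul_mem
        ((Subgroup.closure S).inv_mem (Subgroup.subset_closure hs))
        (Subgroup.subset_closure (hsK k hk))
      rwa [inv_mul_cancel_left] at this
    exact hSgen (Subgroup.isCompact_of_isOpen_of_haar_ne_top μ _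
      (Subgroup.isOpen_of_haar_pos μ _ hKm hKpos hKfin hKH) hHfin)
  · refine hρω.not_ge (limsup_rpow_one_div_le hD hρ0 fun n hn => ?_)
    obtain ⟨m, rfl⟩ := Nat.exists_eq_add_of_le' hn
    exact measure_le_of_sdiff_le μ hD.le hρ1 hdiff m
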